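/- Let $n\ge 1$ and $z\in\mathbb{C}\setminus\{0\}$. The Brauer algebra $\mathcal{B}_n(z)$ is the complex vector space with basis the pair partitions $\pi$ of $\{1,\dots,2n\}$ (the upper row is $1,\dots,n$, the lower row is $n+1,\dots,2n$), with product $\pi\cdot\eta=z^{b(\pi,\eta)}\,\pi\circ\eta$, where $\eta$ is stacked above $\pi$, $\pi\circ\eta$ is the resulting pairing of the outer rows and $b(\pi,\eta)$ is the number of closed loops in the middle row. A permutation $\sigma\in\mathfrak{S}_n$ is identified with the diagram with blocks $\{k,\sigma(k)+n\}$; for $1\le a<b\le n$, $s_{a,b}$ is the diagram of the transposition $(a\ b)$, and $\tau_{a,b}$ is the diagram with blocks $\{a,b\}$, $\{a+n,b+n\}$ and $\{k,k+n\}$ for $k\neq a,b$. For $N\le n$ put $\varepsilon_N=\sum_{\sigma\in\mathfrak{S}_N}\operatorname{sgn}(\sigma)\,\sigma\in\mathbb{C}[\mathfrak{S}_N]\subset\mathbb{C}[\mathfrak{S}_n]\subset\mathcal{B}_n(z)$. For $C\subset\{1,\dots,n\}$ and $1\le i\le n$ put $$Z_C(z)=\frac{(1-z^{-1})|C|}{2}+z^{-1}\sum_{a<b,\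 a,b\in C}s_{a,b}\in\mathcal{B}_n(z),\qquad Z_i(z)=Z_{\{1,\dots,i\}}(z).$$ For $1\le n\le m$, let $p^w$ be the linear projection of $\mathcal{B}_{n+m}(z)$ onto the walled Brauer algebra, that is, onto the span of the diagrams whose blocks joining the two rows do not cross the wall between the first $n$ and the last $m$ positions and whose blocks inside one row do cross it; $p^w$ kills all other diagrams. For $C\subset\{1,\dots,n+m\}$ and $1\le i\le n$ put $$Y_C(z)=p^w(Z_C(z))+\frac{|C|}{2z},\qquad Y_i(z)=Y_{\{1,\dots,i\}\cup\{n+1,\dots,m+i\}}(z)\in\mathcal{B}_{n+m}(z).$$ Let $E_{k,l}$ be the matrix units. The representation $\rho_O:\mathcal{B}_n(N)\to\mathrm{End}((\mathbb{C}^N)^{\otimes n})$ is $\rho_O(\pi)=\sum E_{i_{n+1},i_1}\otimes\cdots\otimes E_{i_{2n},i_n}$, the sum being over all $i_1,\dots,i_{2n}\in\{1,\dots,N\}$ with $i_k=i_l$ whenever $k,l$ lie in the same block of $\pi$. The representation $\rho_S:\mathcal{B}_n(-2N)\to\mathrm{End}((\mathbb{C}^{2N})^{\otimes n})$ is the algebra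 homomorphism such that, for $a<b$, $\rho_S(s_{a,b})$ is minus the transposition of the tensor factors $a$ and $b$, and $\rho_S(\tau_{a,b})=-\sum J_{i_a,i_b}J_{i_{a+n},i_{b+n}}\,E_{i_{a+n},i_a}\otimes E_{i_{b+n},i_b}$ acting on the factors $a$ and $b$, where $J=\begin{pmatrix}0&I_N\\-I_N&0\end{pmatrix}$. For operators $L,J'$ on a finite-dimensional Hermitian space, $L\ge J'$ means that both are self-adjoint and that all eigenvalues of $L-J'$ are non-negative. Let $N>1$ be an integer. Then: 1. for all $1\le n\le m$ and $1\le i\le n$, $\rho_O(Y_i(N))\ge\mathrm{Id}$ on $(\mathbb{C}^N)^{\otimes(n+m)}$; 2. for all $2\le i\le n$, $\rho_S(Z_i(-2N))\ge\mathrm{Id}$, whereas for $i=1\le n$, $\rho_S(Z_1(-2N))=\frac{2N+1}{4N}\,\mathrm{Id}$; 3. for all $1\le i\le n$ with $i\ne N$, $\rho_O(Z_i(N))\ge\frac{N-1}{2N}\,\mathrm{Id}$; 4. for all $n\ge N$, $\rho_O(Z_N(N))\ge\rho_O\left(1-\frac{1}{N!}\varepsilon_N\right)$, while $\varepsilon_N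 Z_N(N)=0$ in $\mathcal{B}_n(N)$. -/

import Mathlib

open scoped BigOperators

noncomputable section

namespace BrauerTensor

/-! ### Brauer diagrams -/

/-- A pair partition of the `2n` points `{1, …, 2n}`. The points `1, …, n` are `Sum.inl 0, …` (upper
row) and the points `n+1, …, 2n` are `Sum.inr 0, …` (lower row). A pair partition is encoded by
the fixed-point-free involution that sends a point to the other point of its block. -/
@[ext]
structure Diagram (n : ℕ) where
  partner : Fin n ⊕ Fin n → Fin n ⊕ Fin n
  invol : ∀ x, partner (partner x) = x
  ne : ∀ x, partner x ≠ x

/-- The diagram of a permutation, with blocks `{k, σ(k) + n}`. -/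
def permDiagram {n : ℕ} (σ : Equiv.Perm (Fin n)) : Diagram n where
  partner := Sum.elim (fun k => Sum.inr (σ k)) (fun k => Sum.inl (σ.symm k))
  invol := by rintro (x | x) <;> simp
  ne := by rintro (x | x) <;> simp

/-- `s_{a,b}`, with blocks `{a, b+n}`, `{b, a+n}` and `{k, k+n}` for `k ≠ a, b`. -/
def sDiagram {n : ℕ} (a b : Fin n) : Diagram n := permDiagram (Equiv.swap a b)

/-! ### Stacking two diagrams

Three rows of `n` points: row 1 is `Sum.inl`, row 2 is `Sum.inr ∘ Sum.inl`, row 3 is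
`Sum.inr ∘ Sum.inr`. In the product `π · η`, the diagram `η` sits on rows 1 and 2 and `π` on rows
2 and 3. -/

/-- The points of three rows of `n` points. -/
abbrev Stack (n : ℕ) : Type := Fin n ⊕ Fin n ⊕ Fin n

/-- Inclusion of the two rows of a diagram as rows 1 and 2. -/
def upper {n : ℕ} : Fin n ⊕ Fin n → Stack n := Sum.elim Sum.inl (fun k => Sum.inr (Sum.inl k))

/-- Inclusion of the two rows of a diagram as rows 2 and 3. -/
def lower {n : ℕ} : Fin n ⊕ Fin n → Stack n := Sum.inr

/-- Inclusion of the two rows of a diagram as rows 1 and 3. -/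
def outer {n : ℕ} : Fin n ⊕ Fin n → Stack n := Sum.elim Sum.inl (fun k => Sum.inr (Sum.inr k))

/-- `x` and `y` are the two points of a block of `η` (on rows 1, 2) or of `π` (on rows 2, 3). -/
def Linked {n : ℕ} (π η : Diagram n) (x y : Stack n) : Prop :=
  (∃ a, x = upper a ∧ y = upper (η.partner a)) ∨ (∃ a, x = lower a ∧ y = lower (π.partner a))

/-- The finest partition of the three rows that is coarser than `η` placed on rows 1, 2 and `π`
placed on rows 2, 3. -/
def join {n : ℕ} (π η : Diagram n) : Setoid (Stack n) := Relation.EqvGen.setoid (Linked π η)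

/-- `b(π, η)`: the number of blocks of the join that are contained in the middle row. -/
def loops {n : ℕ} (π η : Diagram n) : ℕ :=
  Nat.card {c : Quotient (join π η) //
    ∀ x : Stack n, Quotient.mk (join π η) x = c → ∃ k, x = Sum.inr (Sum.inl k)}

theorem exists_period {X : Type*} [Finite X] (r : Equiv.Perm X) (x : X) :
    ∃ m : ℕ, 0 < m ∧ ∀ k : ℤ, (r ^ k) x = x ↔ (m : ℤ) ∣ k := by
  refine ⟨Function.minimalPeriod (fun y : X => r • y) x, ?_, fun k => ?_⟩
  · apply Function.minimalPeriod_pos_of_mem_periodicPts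
    exact Function.Injective.mem_periodicPts (f := fun y : X => r • y) r.injective x
  · exact MulAction.zpow_smul_eq_iff_minimalPeriod_dvd (a := r) (b := x)

theorem involution_orbit {X : Type*} [Finite X] (s t : Equiv.Perm X) (hs : s * s = 1)
    (ht : t * t = 1) (hne : ∀ x, ¬ (s x = x ∧ t x = x)) (x : X) (hx : t x = x) :
    ∃! y, y ≠ x ∧ (s y = y ∨ t y = y) ∧ ∃ k : ℤ, y = ((s * t) ^ k) x := by
  obtain ⟨m, hm, hp⟩ := exists_period (s * t) x
  have hsi : s⁻¹ = s := inv_eq_of_mul_eq_one_left hs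
  have hti : t⁻¹ = t := inv_eq_of_mul_eq_one_left ht
  have hsemi : SemiconjBy t (s * t) (s * t)⁻¹ := by
    rw [SemiconjBy, mul_inv_rev, hsi, hti, mul_assoc]
  have htk : ∀ k : ℤ, t (((s * t) ^ k) x) = ((s * t) ^ (-k)) x := by
    intro k
    have h := congrArg (fun f : Equiv.Perm X => f x) (hsemi.zpow_right k).eq
    simp only [Equiv.Perm.mul_apply, hx] at h
    rw [h, inv_zpow']
  have hsk : ∀ k : ℤ, s (((s * t) ^ k) x) = ((s * t) ^ (1 - k)) x := by
    intro k
    have h : ∀ w, s w = (s * t) (t w) := fun w => by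
      rw [← Equiv.Perm.mul_apply (s * t) t, mul_assoc, ht, mul_one]
    rw [h, htk, sub_eq_add_neg, zpow_one_add, Equiv.Perm.mul_apply (s * t) ((s * t) ^ (-k))]
  have heq : ∀ k l : ℤ, ((s * t) ^ k) x = ((s * t) ^ l) x ↔ (m : ℤ) ∣ k - l := by
    intro k l
    rw [← hp, sub_eq_neg_add, zpow_add, Equiv.Perm.mul_apply, zpow_neg, Equiv.Perm.inv_eq_iff_eq]
  have hm1 : m ≠ 1 := by
    rintro rfl
    refine hne x ⟨?_, hx⟩
    have := (hp 1).2 (by simp)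
    simpa [hx] using this
  have hx0 : ((s * t) ^ (0 : ℤ)) x = x := by simp
  refine ⟨((s * t) ^ (((m + 1) / 2 : ℕ) : ℤ)) x, ⟨?_, ?_, _, rfl⟩, ?_⟩
  · rw [Ne, hp]
    intro h
    have := Nat.le_of_dvd (by omega) (Int.natCast_dvd_natCast.1 h)
    omega
  · rw [hsk, htk, heq, heq]
    rcases Nat.even_or_odd' m with ⟨c, rfl | rfl⟩
    · right
      exact ⟨-1, by omega⟩
    · left
      exact ⟨-1, by omega⟩
  · rintro y ⟨hy, hf, k, rfl⟩
    rw [Ne, hp] at hy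
    rw [hsk, htk, heq, heq] at hf
    rw [heq]
    obtain ⟨e, he⟩ := Nat.even_or_odd' m
    have he2 : (((m + 1) / 2 : ℕ) : ℤ) = if m = 2 * e then (e : ℤ) else e + 1 := by
      split_ifs <;> omega
    rw [he2]
    rcases hf with ⟨c, hc⟩ | ⟨c, hc⟩
    · obtain ⟨d, hd⟩ := Int.even_or_odd' c
      rcases he with rfl | rfl
      · exfalso
        have h2 : 1 - k - k = 2 * ((e : ℤ) * c) := by rw [hc]; push_cast; ring
        omega
      · rcases hd with rfl | rfl
        · exfalso
          have h2 : 1 - k - k = 2 * (((2 * e + 1 : ℕ) : ℤ) * d) := by rw [hc]; ring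
          omega
        · rw [if_neg (by omega)]
          refine ⟨-(d + 1), ?_⟩
          have h2 : 2 * (k - (e + 1)) = 2 * (((2 * e + 1 : ℕ) : ℤ) * -(d + 1)) := by
            push_cast at hc ⊢
            linear_combination -hc
          omega
    · obtain ⟨d, hd⟩ := Int.even_or_odd' c
      rcases hd with rfl | rfl
      · exact absurd ⟨-d, by
          have h2 : -k - k = 2 * ((m : ℤ) * d) := by rw [hc]; ring
          rw [mul_neg]
          omega⟩ hy
      · rcases he with rfl | rfl
        · rw [if_pos rfl]
          refine ⟨-(d + 1), ?_⟩
          have h2 : 2 * (k - e) = 2 * (((2 * e : ℕ) : ℤ) * -(d + 1)) := by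
            push_cast at hc ⊢
            linear_combination -hc
          omega
        · exfalso
          have h2 : -k - k = 2 * (2 * ((e : ℤ) * d) + e + d) + 1 := by
            rw [hc]; push_cast; ring
          omega

/-- The permutation of the three rows given by `η` on rows 1 and 2. -/
def upperPerm {n : ℕ} (η : Diagram n) : Equiv.Perm (Stack n) :=
  Function.Involutive.toPerm
    (Sum.elim (fun a => upper (η.partner (Sum.inl a)))
      (Sum.elim (fun a => upper (η.partner (Sum.inr a))) (fun a => Sum.inr (Sum.inr a))))
    (by
      have key : ∀ y, Sum.elim (fun a => upper (η.partner (Sum.inl a)))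
          (Sum.elim (fun a => upper (η.partner (Sum.inr a))) (fun a => Sum.inr (Sum.inr a)))
            (upper y) = upper (η.partner y) := by
        rintro (y | y) <;> rfl
      rintro (x | x | x)
      · exact (key _).trans (by rw [η.invol]; rfl)
      · exact (key _).trans (by rw [η.invol]; rfl)
      · rfl)

/-- The permutation of the three rows given by `π` on rows 2 and 3. -/
def lowerPerm {n : ℕ} (π : Diagram n) : Equiv.Perm (Stack n) :=
  Function.Involutive.toPerm (Sum.map id π.partner) (by
    rintro (x | x)
    · rfl
    · simp [π.invol])

theorem upperPerm_upper {n : ℕ} (η : Diagram n) (a : Fin n ⊕ Fin n) :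
    upperPerm η (upper a) = upper (η.partner a) := by
  rcases a with a | a <;> rfl

theorem lowerPerm_lower {n : ℕ} (π : Diagram n) (a : Fin n ⊕ Fin n) :
    lowerPerm π (lower a) = lower (π.partner a) := rfl

theorem upper_injective {n : ℕ} : Function.Injective (upper (n := n)) := by
  rintro (a | a) (b | b) h <;> simp_all [upper]

theorem outer_injective {n : ℕ} : Function.Injective (outer (n := n)) := by
  rintro (a | a) (b | b) h <;> simp_all [outer]

theorem upperPerm_fixed {n : ℕ} (η : Diagram n) (x : Stack n) :
    upperPerm η x = x ↔ ∃ a, x = outer (Sum.inr a) := by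
  have key : ∀ a, upperPerm η (upper a) ≠ upper a := fun a h =>
    η.ne a (upper_injective (by rw [← upperPerm_upper, h]))
  rcases x with x | x | x
  · simpa [outer, upper] using key (Sum.inl x)
  · simpa [outer, upper] using key (Sum.inr x)
  · simp [outer, upperPerm, Function.Involutive.toPerm]

theorem lowerPerm_fixed {n : ℕ} (π : Diagram n) (x : Stack n) :
    lowerPerm π x = x ↔ ∃ a, x = outer (Sum.inl a) := by
  rcases x with x | x
  · simp [outer, lowerPerm, Function.Involutive.toPerm]
  · have := π.ne x
    simpa [outer, lowerPerm, Function.Involutive.toPerm] using this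

theorem join_iff_mem_closed {n : ℕ} (π η : Diagram n) (x y : Stack n) (S : Set (Stack n))
    (hu : ∀ z ∈ S, upperPerm η z ∈ S) (hl : ∀ z ∈ S, lowerPerm π z ∈ S) (h : join π η x y) :
    x ∈ S ↔ y ∈ S := by
  have hu' : ∀ z, upperPerm η z ∈ S → z ∈ S := fun z hz => by
    have := hu _ hz
    rwa [show upperPerm η (upperPerm η z) = z from
      Function.Involutive.toPerm_involutive _ z] at this
  have hl' : ∀ z, lowerPerm π z ∈ S → z ∈ S := fun z hz => by
    have := hl _ hz
    rwa [show lowerPerm π (lowerPerm π z) = z from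
      Function.Involutive.toPerm_involutive _ z] at this
  have h' : Relation.EqvGen (Linked π η) x y := h
  clear h
  induction h' with
  | rel x y h =>
    rcases h with ⟨a, rfl, rfl⟩ | ⟨a, rfl, rfl⟩
    · rw [← upperPerm_upper]
      exact ⟨hu _, hu' _⟩
    · rw [← lowerPerm_lower]
      exact ⟨hl _, hl' _⟩
  | refl x => exact Iff.rfl
  | symm x y h ih => exact ih.symm
  | trans x y z h1 h2 ih1 ih2 => exact ih1.trans ih2

theorem join_upperPerm {n : ℕ} (π η : Diagram n) (x : Stack n) :
    join π η x (upperPerm η x) := by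
  rcases x with x | x | x
  · exact Relation.EqvGen.rel _ _ (Or.inl ⟨Sum.inl x, rfl, rfl⟩)
  · exact Relation.EqvGen.rel _ _ (Or.inl ⟨Sum.inr x, rfl, rfl⟩)
  · exact (join π η).refl _

theorem join_lowerPerm {n : ℕ} (π η : Diagram n) (x : Stack n) :
    join π η x (lowerPerm π x) := by
  rcases x with x | x
  · exact (join π η).refl _
  · exact Relation.EqvGen.rel _ _ (Or.inr ⟨x, rfl, rfl⟩)

theorem upperPerm_mul_self {n : ℕ} (η : Diagram n) : upperPerm η * upperPerm η = 1 :=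
  Equiv.ext (Function.Involutive.toPerm_involutive _)

theorem lowerPerm_mul_self {n : ℕ} (π : Diagram n) : lowerPerm π * lowerPerm π = 1 :=
  Equiv.ext (Function.Involutive.toPerm_involutive _)

theorem zpow_orbit {n : ℕ} (π η : Diagram n) (s t : Equiv.Perm (Stack n))
    (hst : (s = upperPerm η ∧ t = lowerPerm π) ∨ (s = lowerPerm π ∧ t = upperPerm η))
    (hs : s * s = 1) (ht : t * t = 1) (x y : Stack n) (hx : t x = x) :
    (∃ k : ℤ, y = ((s * t) ^ k) x) ↔ join π η x y := by
  have hsi : s⁻¹ = s := inv_eq_of_mul_eq_one_left hs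
  have hti : t⁻¹ = t := inv_eq_of_mul_eq_one_left ht
  have hsemi : SemiconjBy t (s * t) (s * t)⁻¹ := by
    rw [SemiconjBy, mul_inv_rev, hsi, hti, mul_assoc]
  have htk : ∀ k : ℤ, t (((s * t) ^ k) x) = ((s * t) ^ (-k)) x := by
    intro k
    have h := congrArg (fun f : Equiv.Perm (Stack n) => f x) (hsemi.zpow_right k).eq
    simp only [Equiv.Perm.mul_apply, hx] at h
    rw [h, inv_zpow']
  have hsk : ∀ k : ℤ, s (((s * t) ^ k) x) = ((s * t) ^ (1 - k)) x := by
    intro k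
    have h : ∀ w, s w = (s * t) (t w) := fun w => by
      rw [← Equiv.Perm.mul_apply (s * t) t, mul_assoc, ht, mul_one]
    rw [h, htk, sub_eq_add_neg, zpow_one_add, Equiv.Perm.mul_apply (s * t) ((s * t) ^ (-k))]
  have hjs : ∀ z, join π η z (s z) := by
    rcases hst with ⟨rfl, rfl⟩ | ⟨rfl, rfl⟩
    · exact join_upperPerm π η
    · exact join_lowerPerm π η
  have hjt : ∀ z, join π η z (t z) := by
    rcases hst with ⟨rfl, rfl⟩ | ⟨rfl, rfl⟩
    · exact join_lowerPerm π η
    · exact join_upperPerm π η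
  constructor
  · rintro ⟨k, rfl⟩
    induction k with
    | zero => exact (join π η).refl _
    | succ k ih =>
      refine (join π η).trans ih ((join π η).trans (hjt _) ?_)
      rw [add_comm, zpow_one_add, Equiv.Perm.mul_apply, Equiv.Perm.mul_apply]
      exact hjs _
    | pred k ih =>
      refine (join π η).trans ih ((join π η).trans (hjs _) ?_)
      rw [sub_eq_add_neg, add_comm, zpow_add, Equiv.Perm.mul_apply, zpow_neg_one, mul_inv_rev,
        hsi, hti, Equiv.Perm.mul_apply]
      exact hjt _
  · intro h
    have hS := join_iff_mem_closed π η x y {z | ∃ k : ℤ, z = ((s * t) ^ k) x}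
    have hs' : ∀ z ∈ {z | ∃ k : ℤ, z = ((s * t) ^ k) x}, s z ∈ {z | ∃ k : ℤ, z = ((s * t) ^ k) x} := by
      rintro z ⟨k, rfl⟩
      exact ⟨_, hsk k⟩
    have ht' : ∀ z ∈ {z | ∃ k : ℤ, z = ((s * t) ^ k) x}, t z ∈ {z | ∃ k : ℤ, z = ((s * t) ^ k) x} := by
      rintro z ⟨k, rfl⟩
      exact ⟨_, htk k⟩
    rcases hst with ⟨rfl, rfl⟩ | ⟨rfl, rfl⟩
    · exact (hS hs' ht' h).1 ⟨0, rfl⟩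
    · exact (hS ht' hs' h).1 ⟨0, rfl⟩

/-- A block of the join that meets rows 1 and 3 meets them in exactly two points. -/
theorem existsUnique_partner {n : ℕ} (π η : Diagram n) (x : Fin n ⊕ Fin n) :
    ∃! y, y ≠ x ∧ join π η (outer x) (outer y) := by
  have main : ∀ s t : Equiv.Perm (Stack n),
      ((s = upperPerm η ∧ t = lowerPerm π) ∨ (s = lowerPerm π ∧ t = upperPerm η)) →
      t (outer x) = outer x → ∃! y, y ≠ x ∧ join π η (outer x) (outer y) := by
    intro s t hst hx
    have hs : s * s = 1 := by
      rcases hst with ⟨rfl, rfl⟩ | ⟨rfl, rfl⟩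
      · exact upperPerm_mul_self η
      · exact lowerPerm_mul_self π
    have ht : t * t = 1 := by
      rcases hst with ⟨rfl, rfl⟩ | ⟨rfl, rfl⟩
      · exact lowerPerm_mul_self π
      · exact upperPerm_mul_self η
    have hfix : ∀ z, (s z = z ∨ t z = z) ↔ ∃ a, z = outer a := by
      intro z
      rcases hst with ⟨rfl, rfl⟩ | ⟨rfl, rfl⟩ <;>
        simp only [upperPerm_fixed, lowerPerm_fixed, Sum.exists]
      tauto
    have hne : ∀ z, ¬ (s z = z ∧ t z = z) := by
      intro z
      rcases hst with ⟨rfl, rfl⟩ | ⟨rfl, rfl⟩ <;>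
        simp only [upperPerm_fixed, lowerPerm_fixed]
      · rintro ⟨⟨a, rfl⟩, ⟨b, hb⟩⟩
        simpa using outer_injective hb
      · rintro ⟨⟨a, rfl⟩, ⟨b, hb⟩⟩
        simpa using outer_injective hb
    obtain ⟨y, ⟨hy1, hy2, hy3⟩, hu⟩ := involution_orbit s t hs ht hne (outer x) hx
    obtain ⟨a, rfl⟩ := (hfix y).1 hy2
    refine ⟨a, ⟨fun h => hy1 (by rw [h]), (zpow_orbit π η s t hst hs ht _ _ hx).1 hy3⟩, ?_⟩
    rintro b ⟨hb1, hb2⟩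
    exact outer_injective (hu (outer b) ⟨fun h => hb1 (outer_injective h),
      (hfix _).2 ⟨b, rfl⟩, (zpow_orbit π η s t hst hs ht _ _ hx).2 hb2⟩)
  rcases x with x | x
  · exact main _ _ (Or.inl ⟨rfl, rfl⟩) ((lowerPerm_fixed _ _).2 ⟨x, rfl⟩)
  · exact main _ _ (Or.inr ⟨rfl, rfl⟩) ((upperPerm_fixed _ _).2 ⟨x, rfl⟩)

/-- The diagram `π ∘ η`: the trace of the join on rows 1 and 3. -/
def comp {n : ℕ} (π η : Diagram n) : Diagram n where
  partner x := (existsUnique_partner π η x).choose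
  invol x := by
    have h1 := (existsUnique_partner π η x).choose_spec.1
    have h2 := (existsUnique_partner π η (existsUnique_partner π η x).choose).choose_spec.2
    exact (h2 x ⟨h1.1.symm, (join π η).symm h1.2⟩).symm
  ne x := (existsUnique_partner π η x).choose_spec.1.1

/-! ### The Brauer algebra -/

/-- The Brauer algebra `B_n(z)`: the complex vector space with basis the pair partitions. -/
def BrauerAlgebra (n : ℕ) (_z : ℂ) : Type := Diagram n →₀ ℂ

instance (n : ℕ) (z : ℂ) : AddCommGroup (BrauerAlgebra n z) :=
  inferInstanceAs (AddCommGroup (Diagram n →₀ ℂ))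

instance (n : ℕ) (z : ℂ) : Module ℂ (BrauerAlgebra n z) :=
  inferInstanceAs (Module ℂ (Diagram n →₀ ℂ))

/-- The basis element of a diagram. -/
def BrauerAlgebra.of {n : ℕ} (z : ℂ) (π : Diagram n) : BrauerAlgebra n z := Finsupp.single π 1

/-- The linear map on `B_n(z)` with prescribed values on the diagrams. -/
def BrauerAlgebra.extend {n : ℕ} (z : ℂ) {M : Type*} [AddCommGroup M] [Module ℂ M]
    (f : Diagram n → M) : BrauerAlgebra n z →ₗ[ℂ] M :=
  Finsupp.linearCombination ℂ f

/-- The bilinear product of `B_n(z)`, determined by `π · η = z ^ b(π, η) (π ∘ η)`. -/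
def BrauerAlgebra.mulMap (n : ℕ) (z : ℂ) :
    BrauerAlgebra n z →ₗ[ℂ] BrauerAlgebra n z →ₗ[ℂ] BrauerAlgebra n z :=
  BrauerAlgebra.extend z fun π => BrauerAlgebra.extend z fun η =>
    z ^ loops π η • BrauerAlgebra.of z (comp π η)

instance (n : ℕ) (z : ℂ) : Mul (BrauerAlgebra n z) := ⟨fun x y => BrauerAlgebra.mulMap n z x y⟩

/-- The unit, with blocks `{k, k + n}`. -/
instance (n : ℕ) (z : ℂ) : One (BrauerAlgebra n z) := ⟨BrauerAlgebra.of z (permDiagram 1)⟩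

/-- `s_{a,b}` as an element of `B_n(z)`. -/
def s {n : ℕ} (z : ℂ) (a b : Fin n) : BrauerAlgebra n z := BrauerAlgebra.of z (sDiagram a b)

/-- `ε_N ∈ ℂ[S_N] ⊆ ℂ[S_n] ⊆ B_n(z)` for `N ≤ n`: the signed sum `∑ sgn(σ) σ` over the
permutations of `{1, …, n}` that fix every point outside `{1, …, N}`. -/
def epsilon (n : ℕ) (z : ℂ) (N : ℕ) : BrauerAlgebra n z :=
  ∑ σ : Equiv.Perm (Fin n) with ∀ k : Fin n, N ≤ (k : ℕ) → σ k = k,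
    ((Equiv.Perm.sign σ : ℤ) : ℂ) • BrauerAlgebra.of z (permDiagram σ)

/-- `Z_C(z) = (1 - z⁻¹)|C|/2 + z⁻¹ ∑_{a < b, a, b ∈ C} s_{a,b}`. -/
def ZSet {n : ℕ} (z : ℂ) (C : Finset (Fin n)) : BrauerAlgebra n z :=
  ((1 - z⁻¹) * (C.card : ℂ) / 2) • (1 : BrauerAlgebra n z) +
    z⁻¹ • ∑ p ∈ C ×ˢ C with p.1 < p.2, s z p.1 p.2

/-- `Z_i(z) = Z_{{1, …, i}}(z)` in `B_n(z)`. -/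
def Z (n : ℕ) (z : ℂ) (i : ℕ) : BrauerAlgebra n z :=
  ZSet z (Finset.univ.filter fun k : Fin n => (k : ℕ) < i)

/-! ### The walled Brauer algebra -/

/-- The diagrams spanning the walled Brauer algebra `B_{n,m}(z)` inside `B_{n+m}(z)`: with a wall
between the first `n` and the last `m` points of each row, blocks joining the two rows stay on one
side of the wall and blocks inside a row cross it. -/
def IsWalled {n m : ℕ} (π : Diagram (n + m)) : Prop :=
  ∀ x : Fin (n + m) ⊕ Fin (n + m),
    let left : Fin (n + m) ⊕ Fin (n + m) → Prop :=
      Sum.elim (fun k => (k : ℕ) < n) (fun k => (k : ℕ) < n)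
    ((π.partner x).isLeft = x.isLeft → (left (π.partner x) ↔ ¬ left x)) ∧
      ((π.partner x).isLeft ≠ x.isLeft → (left (π.partner x) ↔ left x))

open Classical in
/-- The projection `p^w` of `B_{n+m}(z)` onto the span of the walled diagrams, which kills every
other diagram. -/
def wallProj (n m : ℕ) (z : ℂ) : BrauerAlgebra (n + m) z →ₗ[ℂ] BrauerAlgebra (n + m) z :=
  BrauerAlgebra.extend z fun π => if IsWalled (n := n) (m := m) π then BrauerAlgebra.of z π else 0

/-- `Y_C(z) = p^w(Z_C(z)) + |C| z⁻¹ / 2`. -/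
def YSet (n m : ℕ) (z : ℂ) (C : Finset (Fin (n + m))) : BrauerAlgebra (n + m) z :=
  wallProj n m z (ZSet z C) + ((C.card : ℂ) * z⁻¹ / 2) • (1 : BrauerAlgebra (n + m) z)

/-- `Y_i(z) = Y_C(z)` for `C = {1, …, i} ∪ {n + 1, …, m + i}`, where `n ≤ m` and `1 ≤ i ≤ n`. -/
def Y (n m : ℕ) (z : ℂ) (i : ℕ) : BrauerAlgebra (n + m) z :=
  YSet n m z (Finset.univ.filter fun k : Fin (n + m) =>
    (k : ℕ) < i ∨ (n ≤ (k : ℕ) ∧ (k : ℕ) < m + i))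

/-! ### Operators on tensor powers

For `V = ℂ^ι`, the endomorphisms of `V^{⊗n}` are written as matrices in the orthonormal basis
`e_{i_1} ⊗ ⋯ ⊗ e_{i_n}`, indexed by `Fin n → ι`. -/

/-- `A_1 ⊗ ⋯ ⊗ A_n` as a matrix on `V^{⊗n}`. -/
def tensorMatrix {n : ℕ} {ι : Type*} (A : Fin n → Matrix ι ι ℂ) :
    Matrix (Fin n → ι) (Fin n → ι) ℂ :=
  Matrix.of fun j i => ∏ k, A k (j k) (i k)

/-- `E_{i_{n+1}, i_1} ⊗ ⋯ ⊗ E_{i_{2n}, i_n}` for a labelling `I = (i_1, …, i_{2n})`. -/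
def unitTensor {n : ℕ} {ι : Type*} [DecidableEq ι] (I : Fin n ⊕ Fin n → ι) :
    Matrix (Fin n → ι) (Fin n → ι) ℂ :=
  tensorMatrix fun k => Matrix.single (I (Sum.inr k)) (I (Sum.inl k)) 1

/-- `ρ_O(π)`: the sum of `E_{i_{n+1}, i_1} ⊗ ⋯ ⊗ E_{i_{2n}, i_n}` over the labellings that are
constant on the blocks of `π`. -/
def rhoODiagram (N : ℕ) {n : ℕ} (π : Diagram n) : Matrix (Fin n → Fin N) (Fin n → Fin N) ℂ :=
  ∑ I : Fin n ⊕ Fin n → Fin N with ∀ x, I (π.partner x) = I x, unitTensor I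

/-- The representation `ρ_O` of `B_n(N)` on `(ℂ^N)^{⊗n}`. -/
def rhoO (N n : ℕ) : BrauerAlgebra n (N : ℂ) →ₗ[ℂ] Matrix (Fin n → Fin N) (Fin n → Fin N) ℂ :=
  BrauerAlgebra.extend _ (rhoODiagram N)

/-- The matrix `J = [[0, I_N], [-I_N, 0]]` of the symplectic form on `ℂ^{2N}`. -/
def sympJ (N : ℕ) : Matrix (Fin N ⊕ Fin N) (Fin N ⊕ Fin N) ℂ :=
  Matrix.fromBlocks 0 1 (-1) 0

/-- The position of a point in the order `1, …, 2n` (counted from `0`). -/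
def pos {n : ℕ} : Fin n ⊕ Fin n → ℕ := Sum.elim (fun k => (k : ℕ)) (fun k => n + (k : ℕ))

/-- The sign of a diagram: `-1` to the number of pairs of blocks `{x < x'}`, `{y < y'}` with `x < y`
that do not cross, that is, for which `x < y < x' < y'` fails. For the diagram of a permutation this
is the signature, and `τ_{a,b}` has sign `-1`. -/
def diagramSign {n : ℕ} (π : Diagram n) : ℂ :=
  ∏ x : Fin n ⊕ Fin n, ∏ y : Fin n ⊕ Fin n,
    if pos x < pos (π.partner x) ∧ pos y < pos (π.partner y) ∧ pos x < pos y then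
      (if pos y < pos (π.partner x) ∧ pos (π.partner x) < pos (π.partner y) then 1 else -1)
    else 1

/-- The weight of a labelling: the product over the blocks `{x < y}` of `π` of `J_{i_x, i_y}` if
`x` and `y` are in the same row and of `δ_{i_x, i_y}` otherwise. -/
def symplecticWeight {N n : ℕ} (π : Diagram n) (I : Fin n ⊕ Fin n → Fin N ⊕ Fin N) : ℂ :=
  ∏ x : Fin n ⊕ Fin n,
    if pos x < pos (π.partner x) then
      (if x.isLeft = (π.partner x).isLeft then sympJ N (I x) (I (π.partner x))
       else if I x = I (π.partner x) then 1 else 0)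
    else 1

/-- `ρ_S(π)`. In particular `ρ_S(s_{a,b})` is minus the transposition of the tensor factors `a` and
`b`, and `ρ_S(τ_{a,b}) = - ∑ J_{i_a, i_b} J_{i_{a+n}, i_{b+n}} E_{i_{a+n}, i_a} ⊗ E_{i_{b+n}, i_b}`
(on the factors `a < b`, and the identity on the others); these elements generate the algebra. -/
def rhoSDiagram (N : ℕ) {n : ℕ} (π : Diagram n) :
    Matrix (Fin n → Fin N ⊕ Fin N) (Fin n → Fin N ⊕ Fin N) ℂ :=
  diagramSign π • ∑ I : Fin n ⊕ Fin n → Fin N ⊕ Fin N, symplecticWeight π I • unitTensor I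

/-- The representation `ρ_S` of `B_n(-2N)` on `(ℂ^{2N})^{⊗n}`. -/
def rhoS (N n : ℕ) : BrauerAlgebra n (-2 * (N : ℂ)) →ₗ[ℂ]
    Matrix (Fin n → Fin N ⊕ Fin N) (Fin n → Fin N ⊕ Fin N) ℂ :=
  BrauerAlgebra.extend _ (rhoSDiagram N)

/-- `L ≥ J`: both operators are self-adjoint and the eigenvalues of `L - J` are non-negative (they
are real because `L - J` is self-adjoint). -/
def OpGE {κ : Type*} [Fintype κ] [DecidableEq κ] (L J : Matrix κ κ ℂ) : Prop :=
  L.IsHermitian ∧ J.IsHermitian ∧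
    ∀ μ : ℝ, Module.End.HasEigenvalue (Matrix.toLin' (L - J)) (μ : ℂ) → 0 ≤ μ

end BrauerTensor

end

/-! Only permutation diagrams occur in the elements at hand, and on them `rhoO` is the permutation
of tensor factors and `rhoS` the same times the signature. So everything is about `S_C`, the sum
over all ordered pairs in `C` of the transpositions (`swapSum`).

On the factors in `C`, the Casimir operator of `gl_d` is `Cas_C = ∑ E_kl E_lk = (d - 1)|C| + S_C`.
Hence `rhoO` sends `Z_C(N)` to `(Cas_C - |C|) / 2N`, while `rhoS` sends `Z_C(-2N)` to `(Cas_C + |C|)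
/ 4N` with `d = 2N`. The wall splits `C` into `A` and `B` and kills the transpositions across it, so
`Y_C(N)` becomes `(Cas_A + Cas_B) / 2N`.

Since `E_kl` and `E_lk` are adjoint with commutator `E_kk - E_ll`, a vector `f` of weight `ν`
satisfies `2⟨f, Cas f⟩ ≥ (2 ∑ ν_k² + ∑ |ν_k - ν_l|) ‖f‖²` (`casimir_lower_bound`). The Casimir
operator preserves weight spaces, so an eigenvector may be cut down to one of them
(`eigenvalue_lower_bound_of_disjoint`). The first three claims thereby reduce to elementary
inequalities for `ν`.

For `|C| = N` the bound fails to suffice only at the weight `(1, …, 1)`. There, an eigenvector is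
either moved by some `E_kl` to another weight with the same eigenvalue, or killed by all of them; in
the latter case it is antisymmetric, hence seen by `ε_N` (`gap_nonneg`). Finally `ε_N Z_N = 0`
because `ε_N` absorbs each transposition with a sign. -/

noncomputable section

namespace BrauerTensor

/-! ### Operators on words -/

section Words

variable {X ι : Type*}

/-- The number of positions in `C` at which the word `w` has the letter `k`. -/
def letterCount [DecidableEq ι] (C : Finset X) (w : X → ι) (k : ι) : ℕ := (C.filter fun a => w a = k).card

/-- The action of a matrix unit of `gl(ι)` on the tensor factors in `C`. -/
def letterMove [DecidableEq X] [DecidableEq ι] (C : Finset X) (k l : ι) (f : (X → ι) → ℝ) (w : X → ι) : ℝ :=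
  ∑ a ∈ C with w a = k, f (Function.update w a l)

/-- The sum over `a, b ∈ C` (with `a = b` allowed) of the transpositions of the factors `a`, `b`. -/
def swapSum [DecidableEq X] (C : Finset X) (f : (X → ι) → ℝ) (w : X → ι) : ℝ :=
  ∑ a ∈ C, ∑ b ∈ C, f (w ∘ Equiv.swap a b)

theorem sum_letterCount [Fintype ι] [DecidableEq ι] (C : Finset X) (w : X → ι) : ∑ k, letterCount C w k = C.card :=
  (Finset.card_eq_sum_card_fiberwise (fun _ _ => Finset.mem_univ _)).symm

theorem comp_swap_of_eq [DecidableEq X] (w : X → ι) {a b : X} (h : w a = w b) : w ∘ Equiv.swap a b = w := by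
  ext x
  simp only [Function.comp, Equiv.swap_apply_def]
  split_ifs <;> simp_all

theorem update_update_eq_comp_swap [DecidableEq X] (w : X → ι) {a b : X} (hab : a ≠ b) :
    Function.update (Function.update w a (w b)) b (w a) = w ∘ Equiv.swap a b := by
  ext x
  simp only [Function.comp, Equiv.swap_apply_def, Function.update_apply]
  split_ifs <;> simp_all

theorem letterMove_self [DecidableEq X] [DecidableEq ι] (C : Finset X) (k : ι) (f : (X → ι) → ℝ) (w : X → ι) :
    letterMove C k k f w = letterCount C w k * f w := by
  rw [letterMove, letterCount, ← nsmul_eq_mul]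
  refine Finset.sum_eq_card_nsmul fun a ha => ?_
  rw [← (Finset.mem_filter.1 ha).2, Function.update_eq_self]

/-- After a position `a` changes from `k` to `l`, the second move either changes `a` back, giving
the diagonal term, or acts at another position, giving a transposition. When `k = l` the
transpositions fix the word and already account for everything. -/
theorem letterMove_letterMove [DecidableEq X] [DecidableEq ι] (C : Finset X) (k l : ι) (f : (X → ι) → ℝ) (w : X → ι) :
    letterMove C k l (letterMove C l k f) w = (if k = l then 0 else letterCount C w k * f w) +
      ∑ a ∈ C with w a = k, ∑ b ∈ C with w b = l, f (w ∘ Equiv.swap a b) := by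
  split_ifs with h
  · subst h
    rw [letterMove_self, letterMove_self, zero_add, letterCount, ← nsmul_eq_mul, ← nsmul_eq_mul]
    refine (Finset.sum_eq_card_nsmul fun a ha => Finset.sum_eq_card_nsmul fun b hb => ?_).symm
    rw [comp_swap_of_eq w ((Finset.mem_filter.1 ha).2.trans (Finset.mem_filter.1 hb).2.symm)]
  · rw [letterCount, ← nsmul_eq_mul, ← Finset.sum_const, ← Finset.sum_add_distrib, letterMove]
    refine Finset.sum_congr rfl fun a ha => ?_
    obtain ⟨haC, rfl⟩ := Finset.mem_filter.1 ha
    -- The new `l`-positions are the old ones together with `a`; the inserted `a` produces the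
    -- diagonal term.
    have hf : (C.filter fun b => Function.update w a l b = l) =
        insert a (C.filter fun b => w b = l) := by
      ext b
      by_cases hb : b = a
      · subst hb; simp [haC]
      · simp [hb]
    rw [letterMove, hf, Finset.sum_insert (by simp [h]), Function.update_idem,
      Function.update_eq_self]
    congr 1
    refine Finset.sum_congr rfl fun b hb => ?_
    obtain ⟨hbC, rfl⟩ := Finset.mem_filter.1 hb
    rw [update_update_eq_comp_swap w (by rintro rfl; exact h rfl)]

theorem sum_sum_filter [Fintype ι] [DecidableEq ι] (C : Finset X) (w : X → ι) (F : X → ℝ) :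
    ∑ k, ∑ a ∈ C with w a = k, F a = ∑ a ∈ C, F a :=
  Finset.sum_fiberwise C w F

/-- The Casimir operator of `gl(ι)` in terms of transpositions. -/
theorem sum_letterMove_letterMove [DecidableEq X] [Fintype ι] [DecidableEq ι] (C : Finset X) (f : (X → ι) → ℝ) (w : X → ι) :
    ∑ k, ∑ l, letterMove C k l (letterMove C l k f) w =
      ((Fintype.card ι : ℝ) - 1) * C.card * f w + swapSum C f w := by
  simp only [letterMove_letterMove, Finset.sum_add_distrib]
  congr 1
  · have h : ∀ k : ι, ∑ l, (if k = l then 0 else (letterCount C w k : ℝ) * f w) =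
        letterCount C w k * (((Fintype.card ι : ℝ) - 1) * f w) := by
      intro k
      have : ∀ l : ι, (if k = l then 0 else (letterCount C w k : ℝ) * f w) =
          letterCount C w k * f w - if k = l then (letterCount C w k : ℝ) * f w else 0 := by
        intro l; split_ifs <;> ring
      simp only [this, Finset.sum_sub_distrib, Finset.sum_ite_eq, Finset.sum_const,
        Finset.mem_univ, if_true, nsmul_eq_mul, Finset.card_univ]
      ring
    simp only [h]
    rw [← Finset.sum_mul, ← Nat.cast_sum, sum_letterCount]
    ring
  · have h : ∀ k : ι, ∑ l, ∑ a ∈ C with w a = k, ∑ b ∈ C with w b = l, f (w ∘ Equiv.swap a b) =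
        ∑ a ∈ C with w a = k, ∑ b ∈ C, f (w ∘ Equiv.swap a b) := by
      intro k
      rw [Finset.sum_comm]
      simp only [sum_sum_filter]
    simp only [h]
    exact sum_sum_filter C w _

/-- Adjointness of `E_kl` and `E_lk`: for each position `a`, changing the letter there is a
bijection from the words with `k` at `a` to those with `l` at `a`. -/
theorem sum_letterMove_mul [Fintype X] [DecidableEq X] [Fintype ι] [DecidableEq ι] (C : Finset X) (k l : ι) (f g : (X → ι) → ℝ) :
    ∑ w, letterMove C k l f w * g w = ∑ w, f w * letterMove C l k g w := by
  simp only [letterMove, Finset.sum_filter, Finset.sum_mul, Finset.mul_sum]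
  rw [Finset.sum_comm, Finset.sum_comm (s := Finset.univ) (t := C)]
  refine Finset.sum_congr rfl fun a _ => ?_
  simp only [ite_mul, mul_ite, zero_mul, mul_zero, ← Finset.sum_filter]
  refine Finset.sum_nbij' (fun w => Function.update w a l) (fun w => Function.update w a k)
    ?_ ?_ ?_ ?_ ?_
  · simp
  · simp
  · intro w hw; simp [← (Finset.mem_filter.1 hw).2]
  · intro w hw; simp [← (Finset.mem_filter.1 hw).2]
  · intro w hw; simp [← (Finset.mem_filter.1 hw).2]

theorem sum_letterMove_sq [Fintype X] [DecidableEq X] [Fintype ι] [DecidableEq ι] (C : Finset X) (k l : ι) (f : (X → ι) → ℝ) :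
    ∑ w, letterMove C k l f w ^ 2 = ∑ w, f w * letterMove C l k (letterMove C k l f) w := by
  rw [← sum_letterMove_mul]
  simp only [sq]

/-- The relation `[E_kl, E_lk] = E_kk - E_ll` in quadratic form: the transposition terms of the two
products agree and cancel. -/
theorem sum_letterMove_sq_sub [Fintype X] [DecidableEq X] [Fintype ι] [DecidableEq ι] (C : Finset X) {k l : ι} (hkl : k ≠ l) (f : (X → ι) → ℝ) :
    ∑ w, letterMove C l k f w ^ 2 - ∑ w, letterMove C k l f w ^ 2 =
      ∑ w, ((letterCount C w k : ℝ) - letterCount C w l) * f w ^ 2 := by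
  rw [sum_letterMove_sq, sum_letterMove_sq, ← Finset.sum_sub_distrib]
  refine Finset.sum_congr rfl fun w _ => ?_
  have h : ∑ a ∈ C with w a = l, ∑ b ∈ C with w b = k, f (w ∘ Equiv.swap a b) =
      ∑ a ∈ C with w a = k, ∑ b ∈ C with w b = l, f (w ∘ Equiv.swap a b) := by
    rw [Finset.sum_comm]
    simp only [Equiv.swap_comm]
  rw [letterMove_letterMove, letterMove_letterMove, if_neg hkl, if_neg hkl.symm, h]
  ring

/-- A lower bound for the Casimir operator on a weight space. -/
theorem casimir_lower_bound [Fintype X] [DecidableEq X] [Fintype ι] [DecidableEq ι] (C : Finset X) (f : (X → ι) → ℝ) (ν : ι → ℕ)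
    (hf : ∀ w, f w ≠ 0 → letterCount C w = ν) :
    (2 * ∑ k, (ν k : ℝ) ^ 2 + ∑ k, ∑ l, |(ν k : ℝ) - ν l|) * ∑ w, f w ^ 2 ≤
      2 * ∑ w, f w * (((Fintype.card ι : ℝ) - 1) * C.card * f w + swapSum C f w) := by
  have hν : ∀ w k, (letterCount C w k : ℝ) * f w = ν k * f w := by
    intro w k
    by_cases h : f w = 0
    · simp [h]
    · rw [hf w h]
  have hcas : ∑ w, f w * (((Fintype.card ι : ℝ) - 1) * C.card * f w + swapSum C f w) =
      ∑ k, ∑ l, ∑ w, letterMove C l k f w ^ 2 := by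
    simp only [← sum_letterMove_letterMove, Finset.mul_sum, sum_letterMove_sq]
    rw [Finset.sum_comm]
    refine Finset.sum_congr rfl fun k _ => ?_
    rw [Finset.sum_comm]
  have hsymm : ∑ k, ∑ l, ∑ w, letterMove C l k f w ^ 2 =
      ∑ k, ∑ l, ∑ w, letterMove C k l f w ^ 2 := Finset.sum_comm
  -- For `k ≠ l`, two non-negative numbers have a sum at least the absolute value of their
  -- difference, which the commutator gives. For `k = l` there is equality.
  have key : ∀ k l, (2 * (if k = l then (ν k : ℝ) ^ 2 else 0) + |(ν k : ℝ) - ν l|) *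
      ∑ w, f w ^ 2 ≤ ∑ w, letterMove C l k f w ^ 2 + ∑ w, letterMove C k l f w ^ 2 := by
    intro k l
    split_ifs with h
    · subst h
      simp only [letterMove_self, hν, mul_pow, ← Finset.mul_sum]
      simp
      linarith
    · have h1 := sum_letterMove_sq_sub C h f
      have h2 : ∑ w, ((letterCount C w k : ℝ) - letterCount C w l) * f w ^ 2 =
          ((ν k : ℝ) - ν l) * ∑ w, f w ^ 2 := by
        rw [Finset.mul_sum]
        refine Finset.sum_congr rfl fun w _ => ?_
        have h3 := hν w k
        have h4 := hν w l
        linear_combination f w * h3 - f w * h4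
      rw [h2] at h1
      have p1 : 0 ≤ ∑ w, letterMove C l k f w ^ 2 := Finset.sum_nonneg fun _ _ => sq_nonneg _
      have p2 : 0 ≤ ∑ w, letterMove C k l f w ^ 2 := Finset.sum_nonneg fun _ _ => sq_nonneg _
      rcases abs_cases ((ν k : ℝ) - ν l) with ⟨h5, _⟩ | ⟨h5, _⟩ <;> rw [h5] <;> linarith
  have hsum := Finset.sum_le_sum fun k (_ : k ∈ Finset.univ) =>
    Finset.sum_le_sum fun l (_ : l ∈ Finset.univ) => key k l
  simp only [Finset.sum_add_distrib, ← Finset.sum_mul, ← Finset.mul_sum, Finset.sum_ite_eq,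
    Finset.mem_univ, if_true] at hsum
  rw [hcas]
  linarith

theorem letterCount_comp_swap [DecidableEq X] [DecidableEq ι] (C : Finset X) (w : X → ι) {a b : X} (ha : a ∈ C) (hb : b ∈ C) :
    letterCount C (w ∘ Equiv.swap a b) = letterCount C w := by
  ext k
  have hC : ∀ c ∈ C, Equiv.swap a b c ∈ C := by
    intro c hc
    rw [Equiv.swap_apply_def]
    split_ifs <;> assumption
  refine Finset.card_nbij' (Equiv.swap a b) (Equiv.swap a b) ?_ ?_ ?_ ?_
  · intro c hc; simp at hc ⊢; exact ⟨hC _ hc.1, hc.2⟩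
  · intro c hc; simp at hc ⊢; exact ⟨hC _ hc.1, hc.2⟩
  · intro c _; simp
  · intro c _; simp

/-- Restricting to a set of words that is stable under transpositions commutes with `swapSum`. -/
theorem swapSum_indicator [DecidableEq X] (C : Finset X) (f : (X → ι) → ℝ) (S : Set (X → ι))
    (hS : ∀ w, ∀ a ∈ C, ∀ b ∈ C, (w ∘ Equiv.swap a b ∈ S ↔ w ∈ S)) :
    swapSum C (S.indicator f) = S.indicator (swapSum C f) := by
  classical
  ext w
  by_cases hw : w ∈ S
  · rw [Set.indicator_of_mem hw]
    refine Finset.sum_congr rfl fun a ha => Finset.sum_congr rfl fun b hb => ?_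
    rw [Set.indicator_of_mem ((hS w a ha b hb).2 hw)]
  · rw [Set.indicator_of_notMem hw]
    refine Finset.sum_eq_zero fun a ha => Finset.sum_eq_zero fun b hb => ?_
    rw [Set.indicator_of_notMem (fun h => hw ((hS w a ha b hb).1 h))]

/-- One half of Schur–Weyl duality. It lets `gap_nonneg` carry an eigenvector to another weight
without changing its eigenvalue. -/
theorem letterMove_swapSum [DecidableEq X] [DecidableEq ι] (C : Finset X) (k l : ι) (f : (X → ι) → ℝ) :
    swapSum C (letterMove C k l f) = letterMove C k l (swapSum C f) := by
  ext w
  have h : ∀ a ∈ C, ∀ b ∈ C, letterMove C k l f (w ∘ Equiv.swap a b) =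
      ∑ c ∈ C with w c = k, f (Function.update w c l ∘ Equiv.swap a b) := by
    intro a ha b hb
    have hC : ∀ c ∈ C, Equiv.swap a b c ∈ C := by
      intro c hc
      rw [Equiv.swap_apply_def]
      split_ifs <;> assumption
    refine Finset.sum_nbij' (Equiv.swap a b) (Equiv.swap a b) ?_ ?_ ?_ ?_ ?_
    · intro c hc; simp at hc ⊢; exact ⟨hC _ hc.1, hc.2⟩
    · intro c hc; simp at hc ⊢; exact ⟨hC _ hc.1, hc.2⟩
    · intro c _; simp
    · intro c _; simp
    · intro c _
      rw [Function.update_comp_equiv]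
      simp
  rw [swapSum, Finset.sum_congr rfl fun a ha => Finset.sum_congr rfl (h a ha), letterMove]
  simp only [swapSum]
  rw [Finset.sum_comm]
  rw [← Finset.sum_comm]
  rw [Finset.sum_congr rfl fun a _ => Finset.sum_comm, Finset.sum_comm]

theorem letterCount_comp_swap_of_notMem [DecidableEq X] [DecidableEq ι] (C : Finset X) (w : X → ι)
    {a b : X} (ha : a ∉ C) (hb : b ∉ C) :
    letterCount C (w ∘ Equiv.swap a b) = letterCount C w := by
  ext k
  refine congrArg Finset.card (Finset.filter_congr fun c hc => ?_)
  rw [Function.comp_apply, Equiv.swap_apply_of_ne_of_ne] <;> rintro rfl <;> contradiction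

theorem eigenvalue_lower_bound_of_disjoint [Fintype X] [DecidableEq X] [Fintype ι] [DecidableEq ι]
    {A B : Finset X} (hAB : Disjoint A B) (f : (X → ι) → ℝ) (μ : ℝ)
    (hf : ∀ w, swapSum A f w + swapSum B f w = μ * f w) (w₀ : X → ι) (hw₀ : f w₀ ≠ 0) :
    (2 * ∑ k, (letterCount A w₀ k : ℝ) ^ 2 +
        ∑ k, ∑ l, |(letterCount A w₀ k : ℝ) - letterCount A w₀ l|) +
      (2 * ∑ k, (letterCount B w₀ k : ℝ) ^ 2 +
        ∑ k, ∑ l, |(letterCount B w₀ k : ℝ) - letterCount B w₀ l|) ≤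
      2 * (((Fintype.card ι : ℝ) - 1) * (A.card + B.card) + μ) := by
  set S : Set (X → ι) :=
    -- Swaps inside `A` leave the letter counts on `B` alone and vice versa, so both operators
    -- preserve this joint weight space, which contains `w₀`.
    {w | letterCount A w = letterCount A w₀ ∧ letterCount B w = letterCount B w₀}
  set g := S.indicator f
  have hA : swapSum A g = S.indicator (swapSum A f) := by
    refine swapSum_indicator A f S fun w a ha b hb => ?_
    simp only [S, Set.mem_ofPred_eq, letterCount_comp_swap A w ha hb,
      letterCount_comp_swap_of_notMem B w (Finset.disjoint_left.1 hAB ha)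
        (Finset.disjoint_left.1 hAB hb)]
  have hB : swapSum B g = S.indicator (swapSum B f) := by
    refine swapSum_indicator B f S fun w a ha b hb => ?_
    simp only [S, Set.mem_ofPred_eq, letterCount_comp_swap B w ha hb,
      letterCount_comp_swap_of_notMem A w (Finset.disjoint_right.1 hAB ha)
        (Finset.disjoint_right.1 hAB hb)]
  have hg : ∀ w, swapSum A g w + swapSum B g w = μ * g w := by
    classical
    intro w
    rw [hA, hB]
    simp only [g, Set.indicator_apply]
    split_ifs
    · exact hf w
    · simp
  have hS : ∀ w, g w ≠ 0 → w ∈ S := fun w hw => by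
    by_contra h
    exact hw (Set.indicator_of_notMem h f)
  have h1 := casimir_lower_bound A g _ fun w hw => (hS w hw).1
  have h2 := casimir_lower_bound B g _ fun w hw => (hS w hw).2
  have hpos : 0 < ∑ w, g w ^ 2 := by
    refine Finset.sum_pos' (fun _ _ => sq_nonneg _) ⟨w₀, Finset.mem_univ _, ?_⟩
    have hS₀ : w₀ ∈ S := ⟨rfl, rfl⟩
    have : g w₀ = f w₀ := Set.indicator_of_mem hS₀ f
    rw [this]
    positivity
  refine le_of_mul_le_mul_right ?_ hpos
  rw [add_mul]
  refine (add_le_add h1 h2).trans_eq ?_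
  rw [← mul_add, ← Finset.sum_add_distrib, Finset.mul_sum, Finset.mul_sum]
  refine Finset.sum_congr rfl fun w _ => ?_
  linear_combination 2 * g w * hg w

/-- A lower bound for an eigenvalue of `swapSum` in terms of the weight of a word at which an
eigenvector does not vanish. -/
theorem eigenvalue_lower_bound [Fintype X] [DecidableEq X] [Fintype ι] [DecidableEq ι]
    (C : Finset X) (f : (X → ι) → ℝ) (μ : ℝ) (hf : ∀ w, swapSum C f w = μ * f w)
    (w₀ : X → ι) (hw₀ : f w₀ ≠ 0) :
    2 * ∑ k, (letterCount C w₀ k : ℝ) ^ 2 +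
        ∑ k, ∑ l, |(letterCount C w₀ k : ℝ) - letterCount C w₀ l| ≤
      2 * (((Fintype.card ι : ℝ) - 1) * C.card + μ) := by
  have h := eigenvalue_lower_bound_of_disjoint (Finset.disjoint_empty_right C) f μ
    (fun w => by simpa [swapSum] using hf w) w₀ hw₀
  simpa [letterCount] using h

end Words

/-! ### Inequalities for weights -/

section Weights

variable {ι : Type*} [Fintype ι] (ν : ι → ℕ)

/-- Keep only the ordered pairs that contain the maximal letter `m`. -/
theorem two_mul_sum_sub_le [DecidableEq ι] (m : ι) (hm : ∀ k, ν k ≤ ν m) :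
    2 * ∑ k, ((ν m : ℝ) - ν k) ≤ ∑ k, ∑ l, |(ν k : ℝ) - ν l| := by
  have h : ∀ k l : ι, (if k = m then (ν m : ℝ) - ν l else 0) +
      (if l = m then (ν m : ℝ) - ν k else 0) ≤ |(ν k : ℝ) - ν l| := by
    intro k l
    have h1 : (ν k : ℝ) ≤ ν m := by exact_mod_cast hm k
    have h2 : (ν l : ℝ) ≤ ν m := by exact_mod_cast hm l
    split_ifs with h3 h4 h4
    · subst h3; subst h4; simp
    · subst h3; rw [add_zero]; exact le_abs_self _
    · subst h4; rw [abs_sub_comm, zero_add]; exact le_abs_self _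
    · simp
  have := Finset.sum_le_sum fun k (_ : k ∈ Finset.univ) =>
    Finset.sum_le_sum fun l (_ : l ∈ Finset.univ) => h k l
  simp only [Finset.sum_add_distrib, Finset.sum_ite_eq', Finset.mem_univ, if_true] at this
  rw [Finset.sum_comm] at this
  simp only [Finset.sum_ite_eq', Finset.mem_univ, if_true] at this
  linarith

/-- Keep only the pairs that meet `{m, z}`. Each other letter `l` contributes `(ν_m - ν_l) + (ν_l -
0) = ν_m`, and so does the pair `{m, z}` itself. -/
theorem sum_abs_sub_ge_of_zero [DecidableEq ι] (m z : ι) (hm : ∀ k, ν k ≤ ν m) (hz : ν z = 0)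
    (hmz : ν m ≠ 0) :
    2 * ((Fintype.card ι : ℝ) - 1) * ν m ≤ ∑ k, ∑ l, |(ν k : ℝ) - ν l| := by
  have hne : m ≠ z := by rintro rfl; exact hmz hz
  -- The inner corrections at `m` prevent the pair `{m, z}` from being counted twice.
  have h : ∀ k l : ι, ((if k = m then (ν m : ℝ) - ν l else 0) +
      (if l = m then (ν m : ℝ) - ν k else 0)) +
      ((if k = z then (ν l : ℝ) - (if l = m then (ν m : ℝ) else 0) else 0) +
      (if l = z then (ν k : ℝ) - (if k = m then (ν m : ℝ) else 0) else 0)) ≤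
        |(ν k : ℝ) - ν l| := by
    intro k l
    have h1 : (ν k : ℝ) ≤ ν m := by exact_mod_cast hm k
    have h2 : (ν l : ℝ) ≤ ν m := by exact_mod_cast hm l
    have h0 : (ν z : ℝ) = 0 := by exact_mod_cast hz
    have a1 := le_abs_self ((ν k : ℝ) - ν l)
    have a2 := neg_le_abs ((ν k : ℝ) - ν l)
    have a3 := abs_nonneg ((ν k : ℝ) - ν l)
    by_cases k1 : k = m <;> by_cases l1 : l = m <;> by_cases k2 : k = z <;>
      by_cases l2 : l = z <;> simp_all
  have := Finset.sum_le_sum fun k (_ : k ∈ Finset.univ) =>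
    Finset.sum_le_sum fun l (_ : l ∈ Finset.univ) => h k l
  simp only [Finset.sum_add_distrib, Finset.sum_ite_eq', Finset.mem_univ, if_true] at this
  rw [Finset.sum_comm (f := fun k l => if k = m then (ν m : ℝ) - ν l else 0),
    Finset.sum_comm (f := fun k l => if k = z then
      (ν l : ℝ) - (if l = m then (ν m : ℝ) else 0) else 0)] at this
  simp only [Finset.sum_ite_eq', Finset.mem_univ, if_true, Finset.sum_sub_distrib,
    Finset.sum_const, Finset.card_univ, nsmul_eq_mul] at this
  linarith

theorem exists_max_weight (h : 1 ≤ ∑ k, ν k) : ∃ m, (∀ k, ν k ≤ ν m) ∧ 1 ≤ ν m := by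
  have : Nonempty ι := by
    by_contra hn
    rw [not_nonempty_iff] at hn
    simp at h
  obtain ⟨m, hm⟩ := Finite.exists_max ν
  refine ⟨m, hm, ?_⟩
  by_contra h0
  have : ∑ k, ν k = 0 := Finset.sum_eq_zero fun k _ => by have := hm k; omega
  omega

/-- Letter by letter, `ν_k² + (ν_m - ν_k) ≥ ν_m ≥ 1`. -/
theorem two_mul_card_le_weight [DecidableEq ι] (h : 1 ≤ ∑ k, ν k) :
    2 * (Fintype.card ι : ℝ) ≤ 2 * ∑ k, (ν k : ℝ) ^ 2 + ∑ k, ∑ l, |(ν k : ℝ) - ν l| := by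
  obtain ⟨m, hm, hp⟩ := exists_max_weight ν h
  have h1 := two_mul_sum_sub_le ν m hm
  have h2 : ∑ _k : ι, (1 : ℝ) ≤ ∑ k, ((ν k : ℝ) ^ 2 + ((ν m : ℝ) - ν k)) := by
    refine Finset.sum_le_sum fun k _ => ?_
    have : (ν k : ℝ) ≤ (ν k : ℝ) ^ 2 := by exact_mod_cast Nat.le_self_pow two_ne_zero _
    have : (1 : ℝ) ≤ ν m := by exact_mod_cast hp
    linarith
  simp only [Finset.sum_const, Finset.card_univ, nsmul_eq_mul, Finset.sum_add_distrib] at h2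
  linarith

theorem sum_le_sum_sq : ∑ k, (ν k : ℝ) ≤ ∑ k, (ν k : ℝ) ^ 2 :=
  Finset.sum_le_sum fun k _ => by exact_mod_cast Nat.le_self_pow two_ne_zero _

theorem exists_ne_one_dichotomy (h : 1 ≤ ∑ k, ν k) (h1 : ∃ k, ν k ≠ 1) :
    (∃ z, ν z = 0) ∨ ∃ m, (∀ k, ν k ≤ ν m) ∧ 2 ≤ ν m := by
  obtain ⟨m, hm, hp⟩ := exists_max_weight ν h
  by_cases hz : ∃ z, ν z = 0
  · exact Or.inl hz
  · push Not at hz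
    obtain ⟨k, hk⟩ := h1
    have := hz k
    have := hm k
    exact Or.inr ⟨m, hm, by omega⟩

/-- If a letter is missing, the absolute differences alone suffice. Otherwise the maximum is at
least `2`, and `ν_k² - 2ν_k + ν_m ≥ (ν_k - 1)² + 1`. -/
theorem two_mul_card_sub_one_le_weight [DecidableEq ι] (h : 1 ≤ ∑ k, ν k) (h1 : ∃ k, ν k ≠ 1) :
    2 * ((Fintype.card ι : ℝ) - 1) ≤
      2 * ∑ k, (ν k : ℝ) ^ 2 - 2 * ∑ k, (ν k : ℝ) + ∑ k, ∑ l, |(ν k : ℝ) - ν l| := by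
  rcases exists_ne_one_dichotomy ν h h1 with ⟨z, hz⟩ | ⟨m, hm, hp⟩
  · obtain ⟨m, hm, hp⟩ := exists_max_weight ν h
    have h2 := sum_abs_sub_ge_of_zero ν m z hm hz (by omega)
    have h3 := sum_le_sum_sq ν
    have h4 : (1 : ℝ) ≤ ν m := by exact_mod_cast hp
    have h5 : (1 : ℝ) ≤ Fintype.card ι := by
      exact_mod_cast Fintype.card_pos_iff.2 ⟨m⟩
    nlinarith
  · have h2 := two_mul_sum_sub_le ν m hm
    have h3 : ∑ _k : ι, (1 : ℝ) ≤ ∑ k, ((ν k : ℝ) ^ 2 - ν k + ((ν m : ℝ) - ν k)) := by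
      refine Finset.sum_le_sum fun k _ => ?_
      have : (2 : ℝ) ≤ ν m := by exact_mod_cast hp
      nlinarith [sq_nonneg ((ν k : ℝ) - 1)]
    simp only [Finset.sum_const, Finset.card_univ, nsmul_eq_mul, Finset.sum_add_distrib,
      Finset.sum_sub_distrib] at h3 h2
    linarith

/-- With average `1` and not all values `1`, some letter is missing and some letter `m` has `ν_m ≥
2`. The differences then give `4(d - 1)`, with `d` the number of letters, and the term `2(ν_m² -
ν_m)` gives the remaining `4`. -/
theorem four_mul_card_le_weight [DecidableEq ι] (h : ∑ k, ν k = Fintype.card ι)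
    (h1 : ∃ k, ν k ≠ 1) :
    4 * (Fintype.card ι : ℝ) ≤
      2 * ∑ k, (ν k : ℝ) ^ 2 - 2 * ∑ k, (ν k : ℝ) + ∑ k, ∑ l, |(ν k : ℝ) - ν l| := by
  have hsum : ∑ k, ν k = ∑ _k : ι, 1 := by simpa using h
  obtain ⟨z, hz⟩ : ∃ z, ν z = 0 := by
    by_contra hz
    push Not at hz
    have := (Finset.sum_eq_sum_iff_of_le (f := fun _ : ι => 1) (g := ν) (s := Finset.univ)
      fun k _ => Nat.one_le_iff_ne_zero.2 (hz k)).1 hsum.symm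
    obtain ⟨k, hk⟩ := h1
    exact hk (this k (Finset.mem_univ k)).symm
  have hcard : 0 < Fintype.card ι := Fintype.card_pos_iff.2 ⟨z⟩
  obtain ⟨m, hm, -⟩ := exists_max_weight ν (by omega)
  have hp : 2 ≤ ν m := by
    by_contra hp
    have : ∑ k, ν k < ∑ _k : ι, 1 :=
      Finset.sum_lt_sum (fun k _ => by have := hm k; omega) ⟨z, Finset.mem_univ z, by omega⟩
    omega
  have h2 := sum_abs_sub_ge_of_zero ν m z hm hz (by omega)
  have h3 : (ν m : ℝ) ^ 2 - ν m ≤ ∑ k, ((ν k : ℝ) ^ 2 - ν k) :=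
    Finset.single_le_sum (f := fun k => (ν k : ℝ) ^ 2 - ν k) (fun k _ => by
      have : (ν k : ℝ) ≤ (ν k : ℝ) ^ 2 := by exact_mod_cast Nat.le_self_pow two_ne_zero _
      linarith) (Finset.mem_univ m)
  rw [Finset.sum_sub_distrib] at h3
  have h4 : (2 : ℝ) ≤ ν m := by exact_mod_cast hp
  have h5 : (1 : ℝ) ≤ Fintype.card ι := by exact_mod_cast hcard
  nlinarith

theorem four_mul_card_le_weight_add [DecidableEq ι] (h : 2 ≤ ∑ k, ν k) :
    4 * (Fintype.card ι : ℝ) ≤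
      2 * ∑ k, (ν k : ℝ) ^ 2 + 2 * ∑ k, (ν k : ℝ) + ∑ k, ∑ l, |(ν k : ℝ) - ν l| := by
  obtain ⟨m, hm, hp⟩ := exists_max_weight ν (by omega)
  by_cases hp2 : 2 ≤ ν m
  · have h2 := two_mul_sum_sub_le ν m hm
    have h3 : ∑ _k : ι, (2 : ℝ) ≤ ∑ k, ((ν k : ℝ) ^ 2 + ν k + ((ν m : ℝ) - ν k)) := by
      refine Finset.sum_le_sum fun k _ => ?_
      have : (2 : ℝ) ≤ ν m := by exact_mod_cast hp2
      nlinarith [sq_nonneg (ν k : ℝ)]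
    simp only [Finset.sum_const, Finset.card_univ, nsmul_eq_mul, Finset.sum_add_distrib] at h3
    linarith
  · have hν : ∀ k, ν k = 0 ∨ ν k = 1 := fun k => by have := hm k; omega
    have hsq : ∑ k, (ν k : ℝ) ^ 2 = ∑ k, (ν k : ℝ) := Finset.sum_congr rfl fun k _ => by
      rcases hν k with h | h <;> simp [h]
    have habs : ∀ k l, |(ν k : ℝ) - ν l| = ν k + ν l - 2 * (ν k * ν l) := by
      intro k l
      rcases hν k with h | h <;> rcases hν l with h' | h' <;> norm_num [h, h']
    have hD : ∑ k, ∑ l, |(ν k : ℝ) - ν l| =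
        2 * (Fintype.card ι * ∑ k, (ν k : ℝ)) - 2 * ((∑ k, (ν k : ℝ)) * ∑ k, (ν k : ℝ)) := by
      simp only [habs, Finset.sum_sub_distrib, Finset.sum_add_distrib, Finset.sum_const,
        Finset.card_univ, nsmul_eq_mul, ← Finset.mul_sum, ← Finset.sum_mul]
      ring
    have h2 : (2 : ℝ) ≤ ∑ k, (ν k : ℝ) := by exact_mod_cast h
    have h3 : ∑ k, (ν k : ℝ) ≤ Fintype.card ι := by
      have : ∑ k, (ν k : ℝ) ≤ ∑ _k : ι, (1 : ℝ) := Finset.sum_le_sum fun k _ => by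
        rcases hν k with h | h <;> simp [h]
      simpa using this
    rw [hD, hsq]
    -- With `s` letters occurring once and `d` letters in all, the two sides differ by exactly `2(s
    -- - 2)(d - s)`.
    nlinarith [mul_nonneg (sub_nonneg.2 h2) (sub_nonneg.2 h3)]

end Weights

/-! ### Signed sums over the permutations of a set of positions -/

/-- The unordered pairs in `C` and the diagonal make up `C × C`. -/
theorem sum_sum_swap {R E : Type*} [CommRing R] [AddCommGroup E] [Module R E] {n : ℕ}
    (C : Finset (Fin n)) (F : Equiv.Perm (Fin n) → E) :
    ∑ a ∈ C, ∑ b ∈ C, F (Equiv.swap a b) =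
      (C.card : R) • F 1 + (2 : R) • ∑ p ∈ C ×ˢ C with p.1 < p.2, F (Equiv.swap p.1 p.2) := by
  have h : ∀ a b : Fin n, F (Equiv.swap a b) = (if a = b then F 1 else 0) +
      ((if a < b then F (Equiv.swap a b) else 0) +
        if b < a then F (Equiv.swap b a) else 0) := by
    intro a b
    rcases lt_trichotomy a b with h | rfl | h
    · simp [h, h.ne, h.not_gt]
    · simp [Equiv.Perm.one_def]
    · simp [h, h.ne', h.not_gt, Equiv.swap_comm a b]
  rw [Finset.sum_congr rfl fun a _ => Finset.sum_congr rfl fun b _ => h a b]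
  simp only [Finset.sum_add_distrib, Finset.sum_filter, Finset.sum_product, Finset.sum_ite_eq]
  rw [Finset.sum_congr rfl fun a ha => if_pos ha, Finset.sum_const, Nat.cast_smul_eq_nsmul,
    two_smul, Finset.sum_comm (f := fun a b => if b < a then F (Equiv.swap b a) else 0)]

section Antisymmetrizer

variable {X : Type*} [Fintype X] [DecidableEq X]

/-- The permutations that fix every point outside `C`. -/
def permsOn (C : Finset X) : Finset (Equiv.Perm X) :=
  Finset.univ.filter fun σ => ∀ k, k ∉ C → σ k = k

theorem mem_permsOn {C : Finset X} {σ : Equiv.Perm X} :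
    σ ∈ permsOn C ↔ ∀ k, k ∉ C → σ k = k := by simp [permsOn]

theorem mul_mem_permsOn {C : Finset X} {σ τ : Equiv.Perm X} (hσ : σ ∈ permsOn C)
    (hτ : τ ∈ permsOn C) : σ * τ ∈ permsOn C := by
  rw [mem_permsOn] at *
  intro k hk
  rw [Equiv.Perm.mul_apply, hτ k hk, hσ k hk]

theorem inv_mem_permsOn {C : Finset X} {σ : Equiv.Perm X} (hσ : σ ∈ permsOn C) :
    σ⁻¹ ∈ permsOn C := by
  rw [mem_permsOn] at *
  intro k hk
  rw [Equiv.Perm.inv_eq_iff_eq, hσ k hk]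

theorem swap_mem_permsOn {C : Finset X} {a b : X} (ha : a ∈ C) (hb : b ∈ C) :
    Equiv.swap a b ∈ permsOn C := by
  rw [mem_permsOn]
  intro k hk
  exact Equiv.swap_apply_of_ne_of_ne (by rintro rfl; exact hk ha) (by rintro rfl; exact hk hb)

theorem card_permsOn (C : Finset X) : (permsOn C).card = C.card.factorial := by
  have h := Fintype.card_congr (Equiv.Perm.subtypeEquivSubtypePerm fun k => k ∈ C)
  rw [Fintype.card_perm, Fintype.card_coe] at h
  rw [h, permsOn, Fintype.card_subtype]

variable {R E : Type*} [CommRing R] [AddCommGroup E] [Module R E]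

theorem sum_sign_smul_mul_right (C : Finset X) {τ : Equiv.Perm X} (hτ : τ ∈ permsOn C)
    (F : Equiv.Perm X → E) :
    ∑ σ ∈ permsOn C, ((Equiv.Perm.sign σ : ℤ) : R) • F (σ * τ) =
      ((Equiv.Perm.sign τ : ℤ) : R) • ∑ σ ∈ permsOn C, ((Equiv.Perm.sign σ : ℤ) : R) • F σ := by
  rw [Finset.smul_sum]
  refine Finset.sum_nbij' (fun σ => σ * τ) (fun σ => σ * τ⁻¹) ?_ ?_ ?_ ?_ ?_
  · exact fun σ hσ => mul_mem_permsOn hσ hτ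
  · exact fun σ hσ => mul_mem_permsOn hσ (inv_mem_permsOn hτ)
  · intro σ _; simp
  · intro σ _; simp
  · intro σ _
    rw [smul_smul, Equiv.Perm.sign_mul, ← Int.cast_mul, ← Units.val_mul, mul_comm,
      mul_assoc, Int.units_mul_self, mul_one]

theorem sum_sum_sign_swap (C : Finset X) :
    ∑ a ∈ C, ∑ b ∈ C, ((Equiv.Perm.sign (Equiv.swap a b) : ℤ) : R) =
      C.card * (2 - C.card) := by
  have h : ∀ a b : X, ((Equiv.Perm.sign (Equiv.swap a b) : ℤ) : R) =
      (if a = b then 2 else 0) - 1 := by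
    intro a b
    by_cases hab : a = b
    · subst hab; simp; norm_num
    · simp [Equiv.Perm.sign_swap hab, hab]
  simp only [h, Finset.sum_sub_distrib, Finset.sum_ite_eq, Finset.sum_const, nsmul_eq_mul, mul_one]
  rw [Finset.sum_congr rfl fun a ha => if_pos ha, Finset.sum_const, nsmul_eq_mul]
  ring

theorem sum_sign_smul_sum_swap (C : Finset X) (F : Equiv.Perm X → E) :
    ∑ σ ∈ permsOn C, ((Equiv.Perm.sign σ : ℤ) : R) •
        ∑ a ∈ C, ∑ b ∈ C, F (σ * Equiv.swap a b) =
      ((C.card : R) * (2 - C.card)) •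
        ∑ σ ∈ permsOn C, ((Equiv.Perm.sign σ : ℤ) : R) • F σ := by
  simp only [Finset.smul_sum (s := C)]
  rw [Finset.sum_comm, ← sum_sum_sign_swap, Finset.sum_smul]
  refine Finset.sum_congr rfl fun a ha => ?_
  rw [Finset.sum_comm, Finset.sum_smul]
  exact Finset.sum_congr rfl fun b hb => sum_sign_smul_mul_right C (swap_mem_permsOn ha hb) F

variable {ι : Type*}

/-- The signed sum of the permutations of the tensor factors in `C`. -/
def antisymm (C : Finset X) (f : (X → ι) → ℝ) (w : X → ι) : ℝ :=
  ∑ σ ∈ permsOn C, ((Equiv.Perm.sign σ : ℤ) : ℝ) • f (w ∘ σ)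

theorem antisymm_swapSum (C : Finset X) (f : (X → ι) → ℝ) (w : X → ι) :
    antisymm C (swapSum C f) w = C.card * (2 - C.card) * antisymm C f w :=
  sum_sign_smul_sum_swap (R := ℝ) C fun σ => f (w ∘ σ)

theorem antisymm_antisymm (C : Finset X) (f : (X → ι) → ℝ) (w : X → ι) :
    antisymm C (antisymm C f) w = C.card.factorial * antisymm C f w := by
  have h : ∀ σ ∈ permsOn C, ((Equiv.Perm.sign σ : ℤ) : ℝ) •
      ∑ τ ∈ permsOn C, ((Equiv.Perm.sign τ : ℤ) : ℝ) • f (w ∘ (τ * σ : Equiv.Perm X)) =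
      antisymm C f w := by
    intro σ hσ
    rw [sum_sign_smul_mul_right (R := ℝ) C hσ fun τ => f (w ∘ τ), smul_smul, ← Int.cast_mul,
      ← Units.val_mul, Int.units_mul_self, Units.val_one, Int.cast_one, one_smul, antisymm]
  rw [← nsmul_eq_mul, ← card_permsOn, ← Finset.sum_const, ← Finset.sum_congr rfl h]
  simp only [antisymm, Finset.smul_sum]
  rw [Finset.sum_comm]
  refine Finset.sum_congr rfl fun σ _ => Finset.sum_congr rfl fun τ _ => ?_
  rw [smul_comm]
  rfl

/-- Induction on the size of the support: multiplying `σ` on the left by the transposition of `x`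
and `σ x` makes `x` a fixed point. -/
theorem comp_perm_of_antisymmetric (C : Finset X) (f : (X → ι) → ℝ)
    (hf : ∀ a ∈ C, ∀ b ∈ C, a ≠ b → ∀ w, f (w ∘ Equiv.swap a b) = -f w)
    (σ : Equiv.Perm X) (hσ : σ ∈ permsOn C) (w : X → ι) :
    f (w ∘ σ) = ((Equiv.Perm.sign σ : ℤ) : ℝ) * f w := by
  induction h : σ.support.card using Nat.strong_induction_on generalizing σ w with
  | _ m ih =>
    by_cases h1 : σ = 1
    · subst h1; simp
    · obtain ⟨x, hx⟩ : ∃ x, σ x ≠ x := by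
        by_contra hx
        push Not at hx
        exact h1 (Equiv.ext hx)
      have hxC : x ∈ C := by
        by_contra hxC
        exact hx (mem_permsOn.1 hσ x hxC)
      have hσC : σ x ∈ C := by
        by_contra hxC
        exact hx (σ.injective (mem_permsOn.1 hσ _ hxC))
      have hs := swap_mem_permsOn hxC hσC
      have hlt := Equiv.Perm.card_support_swap_mul hx
      have key := ih _ (h ▸ hlt) (Equiv.swap x (σ x) * σ) (mul_mem_permsOn hs hσ)
        (w ∘ Equiv.swap x (σ x)) rfl
      have hcomp : (w ∘ Equiv.swap x (σ x)) ∘ (Equiv.swap x (σ x) * σ : Equiv.Perm X) = w ∘ σ := by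
        ext y; simp
      rw [hcomp, hf x hxC _ hσC hx.symm, Equiv.Perm.sign_mul, Equiv.Perm.sign_swap hx.symm] at key
      rw [key]
      simp

variable [Fintype ι]

theorem sum_comp_perm_sq (f : (X → ι) → ℝ) (σ : Equiv.Perm X) :
    ∑ w : X → ι, f (w ∘ σ) ^ 2 = ∑ w, f w ^ 2 :=
  Equiv.sum_comp (σ.symm.arrowCongr (Equiv.refl ι)) fun w => f w ^ 2

/-- On an eigenspace of `swapSum` for the smallest possible eigenvalue, the transpositions act by
`-1`. -/
theorem antisymmetric_of_swapSum (C : Finset X) (f : (X → ι) → ℝ)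
    (hf : ∀ w, swapSum C f w = C.card * (2 - C.card) * f w) :
    ∀ a ∈ C, ∀ b ∈ C, a ≠ b → ∀ w, f (w ∘ Equiv.swap a b) = -f w := by
  set q := ∑ w, f w ^ 2
  -- The plan is to show that the squared norms of `f + f ∘ (a b)` over `a ≠ b` add up to `0`. The
  -- subtracted `4q` removes the diagonal contribution `‖2f‖²`.
  set e : X → X → ℝ := fun a b =>
    ∑ w, (f w + f (w ∘ Equiv.swap a b)) ^ 2 - if a = b then 4 * q else 0
  have he : ∀ a b, e a b = 2 * q + 2 * ∑ w, f w * f (w ∘ Equiv.swap a b) -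
      if a = b then 4 * q else 0 := by
    intro a b
    have h1 := sum_comp_perm_sq f (Equiv.swap a b)
    simp only [e, add_sq, Finset.sum_add_distrib, h1, mul_assoc, ← Finset.mul_sum]
    ring
  have hnn : ∀ a b, 0 ≤ e a b := by
    intro a b
    by_cases hab : a = b
    · subst hab
      rw [he]
      simp only [Equiv.swap_self, Equiv.coe_refl, Function.comp_id, if_true, ← sq]
      linarith
    · simp only [e, if_neg hab, sub_zero]
      exact Finset.sum_nonneg fun _ _ => sq_nonneg _
  have hzero : ∑ a ∈ C, ∑ b ∈ C, e a b = 0 := by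
    have h1 : ∑ a ∈ C, ∑ b ∈ C, ∑ w, f w * f (w ∘ Equiv.swap a b) =
        ∑ w, f w * swapSum C f w := by
      simp only [swapSum, Finset.mul_sum]
      rw [Finset.sum_congr rfl fun a _ => Finset.sum_comm, Finset.sum_comm]
    have h2 : ∑ w, f w * swapSum C f w = C.card * (2 - C.card) * q := by
      rw [Finset.mul_sum]
      exact Finset.sum_congr rfl fun w _ => by rw [hf]; ring
    have h3 : ∑ a ∈ C, (if a ∈ C then 4 * q else 0) = C.card * (4 * q) := by
      rw [Finset.sum_congr rfl fun a ha => if_pos ha, Finset.sum_const, nsmul_eq_mul]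
    simp only [he, Finset.sum_sub_distrib, Finset.sum_add_distrib, ← Finset.mul_sum, h1, h2,
      Finset.sum_ite_eq, h3, Finset.sum_const, nsmul_eq_mul]
    ring
  intro a ha b hb hab w
  have h1 := (Finset.sum_eq_zero_iff_of_nonneg fun a _ =>
    Finset.sum_nonneg fun b _ => hnn a b).1 hzero a ha
  have h2 := (Finset.sum_eq_zero_iff_of_nonneg fun b _ => hnn a b).1 h1 b hb
  simp only [e, if_neg hab, sub_zero] at h2
  have h3 := (Finset.sum_eq_zero_iff_of_nonneg fun w _ => sq_nonneg _).1 h2 w (Finset.mem_univ w)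
  have := pow_eq_zero_iff two_ne_zero |>.1 h3
  linarith

/-- The spectral gap at the antisymmetric tensors. -/
theorem gap_nonneg [DecidableEq ι] (C : Finset X) (hC : C.card = Fintype.card ι) (hC0 : 0 < C.card)
    (f : (X → ι) → ℝ) (hf0 : f ≠ 0) (μ : ℝ)
    (hf : ∀ w, (1 / (2 * C.card : ℝ)) * ((C.card - 2) * C.card * f w + swapSum C f w) -
      (f w - (1 / C.card.factorial : ℝ) * antisymm C f w) = μ * f w) : 0 ≤ μ := by
  have hM : (0 : ℝ) < C.card := by exact_mod_cast hC0
  have hfac : (C.card.factorial : ℝ) ≠ 0 := by exact_mod_cast C.card.factorial_ne_zero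
  -- If the antisymmetrization of `f` is non-zero, apply it to the eigenvalue equation: both
  -- operators are annihilated, so `μ = 0`.
  by_cases hP : ∃ w, antisymm C f w ≠ 0
  · obtain ⟨w, hw⟩ := hP
    have h1 : antisymm C (fun w => μ * f w) w = μ * antisymm C f w := by
      simp only [antisymm, Finset.mul_sum, smul_eq_mul]
      exact Finset.sum_congr rfl fun _ _ => by ring
    have h2 : antisymm C (fun w => μ * f w) w =
        (1 / (2 * C.card : ℝ)) * ((C.card - 2) * C.card * antisymm C f w +
          antisymm C (swapSum C f) w) -
        (antisymm C f w - (1 / C.card.factorial : ℝ) * antisymm C (antisymm C f) w) := by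
      rw [← funext hf]
      simp only [antisymm, Finset.mul_sum, smul_eq_mul, ← Finset.sum_add_distrib,
        ← Finset.sum_sub_distrib]
      exact Finset.sum_congr rfl fun _ _ => by
        simp only [mul_sub, mul_add, Finset.mul_sum]
        ring_nf
    rw [h1, antisymm_swapSum, antisymm_antisymm, ← mul_assoc _ (C.card.factorial : ℝ),
      one_div_mul_cancel hfac] at h2
    have h3 : μ * antisymm C f w = 0 := by rw [h2]; ring
    exact ((mul_eq_zero.1 h3).resolve_right hw).ge
  · push Not at hP
    -- Now `f` is an eigenvector of `S_C` itself, and `lam` is its eigenvalue.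
    set lam : ℝ := 2 * C.card * (1 + μ) - (C.card - 2) * C.card with hlam
    have hsw : ∀ w, swapSum C f w = lam * f w := by
      intro w
      have h1 := hf w
      rw [hP w, mul_zero, sub_zero] at h1
      field_simp at h1
      rw [hlam]
      linarith
    have bound : ∀ g : (X → ι) → ℝ, (∀ w, swapSum C g w = lam * g w) → ∀ w, g w ≠ 0 →
        (∃ k, letterCount C w k ≠ 1) → 0 ≤ μ := by
      intro g hg w hw hk
      have h1 := eigenvalue_lower_bound C g lam hg w hw
      have h2 := four_mul_card_le_weight (letterCount C w) ((sum_letterCount C w).trans hC) hk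
      rw [← Nat.cast_sum, sum_letterCount] at h2
      rw [← hC] at h1 h2
      rw [hlam] at h1
      have h3 : 0 ≤ C.card * μ := by nlinarith
      exact nonneg_of_mul_nonneg_right h3 hM
    obtain ⟨w₀, hw₀⟩ := Function.ne_iff.1 hf0
    by_contra hμ
    have hone : ∀ w, f w ≠ 0 → ∀ k, letterCount C w k = 1 := by
      intro w hw k
      by_contra hk
      exact hμ (bound f hsw w hw ⟨k, hk⟩)
    -- A word where `E_kl f` is non-zero arises from one of weight `(1, …, 1)` by adding a letter
    -- `k`, so its weight is different and `bound` applies.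
    have hmove : ∀ k l, k ≠ l → ∀ w, letterMove C k l f w = 0 := by
      intro k l hkl w
      by_contra hw
      refine hμ (bound (letterMove C k l f) ?_ w hw ⟨k, ?_⟩)
      · intro w
        rw [letterMove_swapSum, funext hsw]
        simp only [letterMove, Finset.mul_sum]
      · obtain ⟨a, ha, hfa⟩ := Finset.exists_ne_zero_of_sum_ne_zero hw
        obtain ⟨haC, rfl⟩ := Finset.mem_filter.1 ha
        intro h1
        have h2 := hone _ hfa (w a)
        have h3 : (C.filter fun b => Function.update w a l b = w a) ⊆
            (C.filter fun b => w b = w a).erase a := by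
          intro b hb
          have hb' := Finset.mem_filter.1 hb
          by_cases hba : b = a
          · subst hba
            simp at hb'
            exact absurd hb'.2.symm hkl
          · simp [hba] at hb'
            simp [hba, hb']
        have h4 := Finset.card_le_card h3
        rw [Finset.card_erase_of_mem ha] at h4
        rw [letterCount] at h1 h2
        omega
    -- Only the diagonal terms `E_kk²` of the Casimir operator survive, so it acts on `f` at `w₀` by
    -- `|C|`. This determines `lam` as the value attained on antisymmetric tensors.
    have hlam2 : lam = C.card * (2 - C.card) := by
      have h1 := sum_letterMove_letterMove C f w₀
      have h2 : ∀ k, ∑ l, letterMove C k l (letterMove C l k f) w₀ = f w₀ := by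
        intro k
        rw [Finset.sum_eq_single k]
        · rw [letterMove_self, letterMove_self, hone w₀ hw₀]
          simp
        · intro l _ hl
          rw [funext (hmove l k hl)]
          simp [letterMove]
        · simp
      simp only [h2, Finset.sum_const, Finset.card_univ, nsmul_eq_mul, hsw, ← hC] at h1
      have h3 : (C.card - ((C.card - 1) * C.card + lam)) * f w₀ = 0 := by linear_combination h1
      have := (mul_eq_zero.1 h3).resolve_right hw₀
      linarith
    have hanti := antisymmetric_of_swapSum C f (hlam2 ▸ hsw)
    have h1 : antisymm C f w₀ = C.card.factorial * f w₀ := by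
      have h2 : ∀ σ ∈ permsOn C, ((Equiv.Perm.sign σ : ℤ) : ℝ) • f (w₀ ∘ σ) = f w₀ := by
        intro σ hσ
        rw [comp_perm_of_antisymmetric C f hanti σ hσ, smul_eq_mul, ← mul_assoc, ← Int.cast_mul,
          ← Units.val_mul, Int.units_mul_self]
        simp
      rw [antisymm, Finset.sum_congr rfl h2, Finset.sum_const, card_permsOn, nsmul_eq_mul]
    rw [hP] at h1
    exact mul_ne_zero hfac hw₀ h1.symm

end Antisymmetrizer

/-! ### Products of permutation diagrams -/

section Products

variable {n : ℕ}

theorem join_inl (π η : Equiv.Perm (Fin n)) (k : Fin n) :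
    join (permDiagram π) (permDiagram η) (Sum.inl k) (Sum.inr (Sum.inr (π (η k)))) :=
  (join _ _).trans (join_upperPerm _ (permDiagram η) (Sum.inl k))
    (join_lowerPerm (permDiagram π) _ (Sum.inr (Sum.inl (η k))))

theorem comp_permDiagram (π η : Equiv.Perm (Fin n)) :
    comp (permDiagram π) (permDiagram η) = permDiagram (π * η) := by
  ext x
  refine ((existsUnique_partner (permDiagram π) (permDiagram η) x).choose_spec.2 _ ?_).symm
  refine ⟨(permDiagram (π * η)).ne x, ?_⟩
  rcases x with k | k
  · exact join_inl π η k
  · refine (join _ _).symm ?_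
    have := join_inl π η ((π * η).symm k)
    rwa [← Equiv.Perm.mul_apply, Equiv.apply_symm_apply] at this

/-- Every point of the middle row is joined to one of row 3, so no block lies inside the middle row.
-/
theorem loops_permDiagram (π η : Equiv.Perm (Fin n)) :
    loops (permDiagram π) (permDiagram η) = 0 := by
  have : IsEmpty {c : Quotient (join (permDiagram π) (permDiagram η)) //
      ∀ x : Stack n, Quotient.mk (join (permDiagram π) (permDiagram η)) x = c →
        ∃ k, x = Sum.inr (Sum.inl k)} := by
    refine ⟨fun ⟨c, hc⟩ => ?_⟩
    induction c using Quotient.inductionOn with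
    | _ x =>
      obtain ⟨k, rfl⟩ := hc x rfl
      obtain ⟨l, hl⟩ := hc (Sum.inr (Sum.inr (π k))) (Quotient.sound ((join _ _).symm
        (join_lowerPerm (permDiagram π) (permDiagram η) (Sum.inr (Sum.inl k)))))
      simp at hl
  exact Nat.card_of_isEmpty

variable (z : ℂ)

theorem extend_of {M : Type*} [AddCommGroup M] [Module ℂ M] (f : Diagram n → M) (π : Diagram n) :
    BrauerAlgebra.extend z f (BrauerAlgebra.of z π) = f π :=
  (Finsupp.linearCombination_single ℂ 1 π).trans (one_smul ℂ (f π))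

theorem mulMap_permDiagram (σ τ : Equiv.Perm (Fin n)) :
    BrauerAlgebra.mulMap n z (BrauerAlgebra.of z (permDiagram σ))
      (BrauerAlgebra.of z (permDiagram τ)) = BrauerAlgebra.of z (permDiagram (σ * τ)) := by
  rw [BrauerAlgebra.mulMap, extend_of, extend_of, loops_permDiagram, comp_permDiagram, pow_zero,
    one_smul]

theorem epsilon_eq (N : ℕ) : epsilon n z N =
    ∑ σ ∈ permsOn (Finset.univ.filter fun k : Fin n => (k : ℕ) < N),
      ((Equiv.Perm.sign σ : ℤ) : ℂ) • BrauerAlgebra.of z (permDiagram σ) := by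
  rw [epsilon, permsOn]
  congr! 4
  simp

theorem card_filter_lt {i : ℕ} (hi : i ≤ n) :
    (Finset.univ.filter fun k : Fin n => (k : ℕ) < i).card = i := by
  rw [Fin.card_filter_val_lt, min_eq_right hi]

theorem epsilon_mulMap_permDiagram (N : ℕ) {τ : Equiv.Perm (Fin n)}
    (hτ : τ ∈ permsOn (Finset.univ.filter fun k : Fin n => (k : ℕ) < N)) :
    BrauerAlgebra.mulMap n z (epsilon n z N) (BrauerAlgebra.of z (permDiagram τ)) =
      ((Equiv.Perm.sign τ : ℤ) : ℂ) • epsilon n z N := by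
  rw [epsilon_eq, ← sum_sign_smul_mul_right _ hτ, map_sum, LinearMap.sum_apply]
  refine Finset.sum_congr rfl fun σ _ => ?_
  rw [map_smul, LinearMap.smul_apply, mulMap_permDiagram]

/-- The image of `Z_C(z)` under a linear map, as a sum over all ordered pairs. -/
theorem map_ZSet {E : Type*} [AddCommGroup E] [Module ℂ E] (hz : z ≠ 0) (C : Finset (Fin n))
    (Φ : BrauerAlgebra n z →ₗ[ℂ] E) :
    Φ (ZSet z C) = (2 * z)⁻¹ • (((z - 2) * C.card) • Φ (BrauerAlgebra.of z (permDiagram 1)) +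
      ∑ a ∈ C, ∑ b ∈ C, Φ (BrauerAlgebra.of z (permDiagram (Equiv.swap a b)))) := by
  rw [sum_sum_swap (R := ℂ) C fun σ => Φ (BrauerAlgebra.of z (permDiagram σ)), ZSet, map_add,
    map_smul, map_smul, map_sum, smul_add, smul_add, smul_smul, smul_smul, smul_smul, ← add_assoc,
    ← add_smul]
  congr 2
  · field_simp
    ring
  · field_simp

theorem epsilon_mul_Z {N : ℕ} (hN : N ≠ 0) (hn : N ≤ n) :
    epsilon n (N : ℂ) N * Z n (N : ℂ) N = 0 := by
  change BrauerAlgebra.mulMap n (N : ℂ) (epsilon n N N) (ZSet _ _) = 0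
  rw [map_ZSet _ (by exact_mod_cast hN), Finset.sum_congr rfl fun a ha =>
    Finset.sum_congr rfl fun b hb => epsilon_mulMap_permDiagram _ N (swap_mem_permsOn ha hb),
    epsilon_mulMap_permDiagram _ N (mem_permsOn.2 fun _ _ => rfl)]
  simp only [← Finset.sum_smul]
  rw [sum_sum_sign_swap, card_filter_lt hn, smul_smul, ← add_smul]
  simp only [Equiv.Perm.sign_one, Units.val_one, Int.cast_one, mul_one]
  -- The signs of the ordered pairs add up to `N(2 - N)`, which cancels the scalar part.
  rw [show ((N : ℂ) - 2) * N + N * (2 - N) = 0 by ring, zero_smul, smul_zero]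

end Products

/-! ### Permutation operators on tensor powers -/

section Operators

variable {X ι : Type*} [Fintype X] [DecidableEq ι]

/-- The permutation operator of `σ` on functions of words, with real entries. -/
def permMat (ι : Type*) [DecidableEq ι] (σ : Equiv.Perm X) : Matrix (X → ι) (X → ι) ℝ :=
  Matrix.of fun j i => if i = j ∘ σ then 1 else 0

theorem permMat_one [DecidableEq X] : permMat (X := X) ι 1 = 1 := by
  ext j i
  simp [permMat, Matrix.one_apply, eq_comm]

theorem permMat_transpose (σ : Equiv.Perm X) : (permMat ι σ).transpose = permMat ι σ⁻¹ := by
  ext j i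
  have : j = i ∘ σ ↔ i = j ∘ ⇑σ⁻¹ := by
    constructor
    · rintro rfl; ext x; simp
    · rintro rfl; ext x; simp
  simp [permMat, this]

variable [DecidableEq X]

theorem permMat_mulVec [Fintype ι] (σ : Equiv.Perm X) (f : (X → ι) → ℝ) (w : X → ι) :
    (permMat ι σ).mulVec f w = f (w ∘ σ) := by
  simp [permMat, Matrix.mulVec, dotProduct]

/-- The matrix of `swapSum`. -/
def swapMat (ι : Type*) [DecidableEq ι] (C : Finset X) : Matrix (X → ι) (X → ι) ℝ :=
  ∑ a ∈ C, ∑ b ∈ C, permMat ι (Equiv.swap a b)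

theorem swapMat_mulVec [Fintype ι] (C : Finset X) (f : (X → ι) → ℝ) (w : X → ι) :
    (swapMat ι C).mulVec f w = swapSum C f w := by
  simp only [swapMat, Matrix.sum_mulVec, Finset.sum_apply, permMat_mulVec, swapSum]

theorem swapMat_isSymm (C : Finset X) : (swapMat ι C).IsSymm := by
  simp only [Matrix.IsSymm, swapMat, Matrix.transpose_sum, permMat_transpose, Equiv.swap_inv]

/-- The matrix of `antisymm`. -/
def antisymmMat (ι : Type*) [DecidableEq ι] (C : Finset X) : Matrix (X → ι) (X → ι) ℝ :=
  ∑ σ ∈ permsOn C, ((Equiv.Perm.sign σ : ℤ) : ℝ) • permMat ι σ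

theorem antisymmMat_mulVec [Fintype ι] (C : Finset X) (f : (X → ι) → ℝ) (w : X → ι) :
    (antisymmMat ι C).mulVec f w = antisymm C f w := by
  simp only [antisymmMat, Matrix.sum_mulVec, Finset.sum_apply, Matrix.smul_mulVec, Pi.smul_apply,
    permMat_mulVec, antisymm]

theorem antisymmMat_isSymm (C : Finset X) : (antisymmMat ι C).IsSymm := by
  simp only [Matrix.IsSymm, antisymmMat, Matrix.transpose_sum, Matrix.transpose_smul,
    permMat_transpose]
  refine Finset.sum_nbij' (fun σ => σ⁻¹) (fun σ => σ⁻¹) ?_ ?_ ?_ ?_ ?_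
  · exact fun σ hσ => inv_mem_permsOn hσ
  · exact fun σ hσ => inv_mem_permsOn hσ
  · intro σ _; simp
  · intro σ _; simp
  · intro σ _; simp

end Operators

/-- Reduction to real eigenvectors: for a real matrix and a real eigenvalue, the real and imaginary
parts of an eigenvector satisfy the same equation, and one of them is non-zero. -/
theorem opGE_map_ofReal {κ : Type*} [Fintype κ] [DecidableEq κ] {A B : Matrix κ κ ℝ}
    (hA : A.IsSymm) (hB : B.IsSymm)
    (h : ∀ f : κ → ℝ, f ≠ 0 → ∀ μ : ℝ, (∀ w, A.mulVec f w - B.mulVec f w = μ * f w) → 0 ≤ μ) :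
    OpGE (A.map Complex.ofReal) (B.map Complex.ofReal) := by
  have herm : ∀ A : Matrix κ κ ℝ, A.IsSymm → (A.map Complex.ofReal).IsHermitian := by
    intro A hA
    ext i j
    simp [Matrix.conjTranspose_apply, hA.apply i j]
  refine ⟨herm A hA, herm B hB, fun μ hμ => ?_⟩
  obtain ⟨v, hv⟩ := hμ.exists_hasEigenvector
  have hv1 := hv.apply_eq_smul
  rw [Matrix.toLin'_apply, Matrix.sub_mulVec] at hv1
  have hre : ∀ w, A.mulVec (fun x => (v x).re) w - B.mulVec (fun x => (v x).re) w =
      μ * (v w).re := by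
    intro w
    have := congrArg Complex.re (congrFun hv1 w)
    simpa [Matrix.mulVec, dotProduct, Complex.re_sum] using this
  have him : ∀ w, A.mulVec (fun x => (v x).im) w - B.mulVec (fun x => (v x).im) w =
      μ * (v w).im := by
    intro w
    have := congrArg Complex.im (congrFun hv1 w)
    simpa [Matrix.mulVec, dotProduct, Complex.im_sum] using this
  by_cases h0 : (fun x => (v x).re) = 0
  · refine h _ (fun h1 => hv.2 ?_) μ him
    ext x
    exact Complex.ext (congrFun h0 x) (congrFun h1 x)
  · exact h _ h0 μ hre

/-! ### The representations on permutation diagrams -/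

section Representations

variable {n : ℕ}

theorem unitTensor_apply {ι : Type*} [DecidableEq ι] (I : Fin n ⊕ Fin n → ι) (j i : Fin n → ι) :
    unitTensor I j i = if I = Sum.elim i j then 1 else 0 := by
  have : I = Sum.elim i j ↔ ∀ k, I (Sum.inr k) = j k ∧ I (Sum.inl k) = i k := by
    rw [funext_iff, Sum.forall, ← forall_and]
    simp [and_comm]
  simp only [unitTensor, tensorMatrix, Matrix.of_apply, Matrix.single_apply, this]
  rw [Finset.prod_ite_zero]
  simp

theorem rhoODiagram_permDiagram (N : ℕ) (σ : Equiv.Perm (Fin n)) :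
    rhoODiagram N (permDiagram σ) = (permMat (Fin N) σ).map Complex.ofReal := by
  ext j i
  have : (∀ x, (Sum.elim i j : Fin n ⊕ Fin n → Fin N) ((permDiagram σ).partner x) =
      (Sum.elim i j : Fin n ⊕ Fin n → Fin N) x) ↔ i = j ∘ σ := by
    constructor
    · intro h
      ext k
      exact congrArg _ (h (Sum.inl k)).symm
    · rintro rfl (k | k) <;> simp [permDiagram]
  simp only [rhoODiagram, Matrix.sum_apply, unitTensor_apply, Finset.sum_ite_eq',
    Finset.mem_filter, Finset.mem_univ, true_and, this, permMat, Matrix.map_apply, Matrix.of_apply]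
  split_ifs <;> simp

/-- Each block starts in the upper row, and the blocks of `k < l` fail to cross exactly when `(k,
l)` is an inversion. -/
theorem diagramSign_permDiagram (σ : Equiv.Perm (Fin n)) :
    diagramSign (permDiagram σ) = ((Equiv.Perm.sign σ : ℤ) : ℂ) := by
  have h1 : ∀ a b : Fin n, (a : ℕ) < n + b := fun a b => by omega
  have h2 : ∀ a b : Fin n, ¬ (n + (a : ℕ) < b) := fun a b => by omega
  rw [Equiv.Perm.sign_eq_prod_prod_Ioi]
  simp only [diagramSign, Fintype.prod_sum_type, permDiagram, pos, Sum.elim_inl, Sum.elim_inr,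
    h1, h2, true_and, false_and, and_false, if_false, Finset.prod_const_one, mul_one,
    add_lt_add_iff_left, Fin.val_fin_lt, Units.coe_prod, Int.cast_prod]
  refine Finset.prod_congr rfl fun k _ => ?_
  rw [← Finset.prod_filter, Finset.filter_lt_eq_Ioi]
  refine Finset.prod_congr rfl fun l _ => ?_
  split_ifs <;> simp

theorem symplecticWeight_permDiagram {N : ℕ} (σ : Equiv.Perm (Fin n))
    (i j : Fin n → Fin N ⊕ Fin N) :
    symplecticWeight (permDiagram σ) (Sum.elim i j) = if i = j ∘ σ then 1 else 0 := by
  have h1 : ∀ a b : Fin n, (a : ℕ) < n + b := fun a b => by omega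
  have h2 : ∀ a b : Fin n, ¬ (n + (a : ℕ) < b) := fun a b => by omega
  simp only [symplecticWeight, Fintype.prod_sum_type, permDiagram, pos, Sum.elim_inl,
    Sum.elim_inr, h1, h2, if_false, if_true, Finset.prod_const_one, mul_one, Sum.isLeft_inl,
    Sum.isLeft_inr, Bool.true_eq_false]
  trans ∏ k, if i k = j (σ k) then (1 : ℂ) else 0
  · congr!
  · rw [Finset.prod_ite_zero]
    simp [funext_iff]

theorem rhoSDiagram_permDiagram (N : ℕ) (σ : Equiv.Perm (Fin n)) :
    rhoSDiagram N (permDiagram σ) = ((Equiv.Perm.sign σ : ℤ) : ℂ) •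
      (permMat (Fin N ⊕ Fin N) σ).map Complex.ofReal := by
  rw [rhoSDiagram, diagramSign_permDiagram]
  congr 1
  ext j i
  simp only [Matrix.sum_apply, Matrix.smul_apply, unitTensor_apply, smul_eq_mul, mul_ite, mul_one,
    mul_zero, Finset.sum_ite_eq', Finset.mem_univ, if_true, symplecticWeight_permDiagram, permMat,
    Matrix.map_apply, Matrix.of_apply]
  split_ifs <;> simp

theorem isWalled_permDiagram {n m : ℕ} (σ : Equiv.Perm (Fin (n + m))) :
    IsWalled (n := n) (m := m) (permDiagram σ) ↔
      ∀ k, ((σ k : Fin (n + m)) : ℕ) < n ↔ (k : ℕ) < n := by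
  constructor
  · intro h k
    simpa [permDiagram] using (h (Sum.inl k)).2
  · rintro h (k | k)
    · simpa [permDiagram] using h k
    · simpa [permDiagram] using (h (σ.symm k)).symm

theorem isWalled_swap {n m : ℕ} (a b : Fin (n + m)) :
    IsWalled (n := n) (m := m) (permDiagram (Equiv.swap a b)) ↔ ((a : ℕ) < n ↔ (b : ℕ) < n) := by
  rw [isWalled_permDiagram]
  constructor
  · intro h
    simpa using (h a).symm
  · intro h k
    rw [Equiv.swap_apply_def]
    split_ifs with h1 h2
    · rw [h1, h]
    · rw [h2, h]
    · rfl

end Representations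

/-! ### Images of `Z_C`, `Y_C` and `ε_N` as real matrices -/

section Representations

variable {n : ℕ}

theorem rhoO_permDiagram (N : ℕ) (σ : Equiv.Perm (Fin n)) :
    rhoO N n (BrauerAlgebra.of (N : ℂ) (permDiagram σ)) =
      (permMat (Fin N) σ).map Complex.ofReal := by
  rw [rhoO, extend_of, rhoODiagram_permDiagram]

theorem rhoS_permDiagram (N : ℕ) (σ : Equiv.Perm (Fin n)) :
    rhoS N n (BrauerAlgebra.of (-2 * (N : ℂ)) (permDiagram σ)) =
      ((Equiv.Perm.sign σ : ℤ) : ℂ) • (permMat (Fin N ⊕ Fin N) σ).map Complex.ofReal := by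
  rw [rhoS, extend_of, rhoSDiagram_permDiagram]

theorem one_map_ofReal {κ : Type*} [DecidableEq κ] :
    (1 : Matrix κ κ ℝ).map Complex.ofReal = 1 :=
  Matrix.map_one _ Complex.ofReal_zero Complex.ofReal_one

theorem ofReal_one_apply {κ : Type*} [DecidableEq κ] (j i : κ) :
    (((1 : Matrix κ κ ℝ) j i : ℝ) : ℂ) = (1 : Matrix κ κ ℂ) j i := by
  rw [← one_map_ofReal, Matrix.map_apply]

theorem smul_one_map_ofReal {κ : Type*} [DecidableEq κ] (r : ℝ) :
    (r • (1 : Matrix κ κ ℝ)).map Complex.ofReal = (r : ℂ) • 1 := by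
  ext j i
  simp [ofReal_one_apply]

theorem rhoO_ZSet {N : ℕ} (hN : N ≠ 0) (C : Finset (Fin n)) :
    rhoO N n (ZSet (N : ℂ) C) =
      ((2 * N : ℝ)⁻¹ • (((N - 2 : ℝ) * C.card) • 1 + swapMat (Fin N) C)).map Complex.ofReal := by
  rw [map_ZSet _ (by exact_mod_cast hN)]
  simp only [rhoO_permDiagram, permMat_one]
  ext j i
  simp [swapMat, Matrix.sum_apply, ofReal_one_apply, mul_add]

theorem rhoS_ZSet {N : ℕ} (hN : N ≠ 0) (C : Finset (Fin n)) :
    rhoS N n (ZSet (-2 * (N : ℂ)) C) =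
      ((4 * N : ℝ)⁻¹ • ((2 * N * C.card : ℝ) • 1 + swapMat (Fin N ⊕ Fin N) C)).map
        Complex.ofReal := by
  have hN' : (N : ℂ) ≠ 0 := by exact_mod_cast hN
  rw [map_ZSet _ (by simpa using hN)]
  simp only [rhoS_permDiagram]
  have hsum : ∑ a ∈ C, ∑ b ∈ C, ((Equiv.Perm.sign (Equiv.swap a b) : ℤ) : ℂ) •
      (permMat (Fin N ⊕ Fin N) (Equiv.swap a b)).map Complex.ofReal =
      (2 * C.card : ℂ) • 1 - (swapMat (Fin N ⊕ Fin N) C).map Complex.ofReal := by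
    -- The signature is `-1` off the diagonal and `+1` on it; the term `2` corrects the diagonal.
    have h : ∀ a b : Fin n, ((Equiv.Perm.sign (Equiv.swap a b) : ℤ) : ℂ) •
        (permMat (Fin N ⊕ Fin N) (Equiv.swap a b)).map Complex.ofReal =
        (if a = b then (2 : ℂ) • 1 else 0) -
          (permMat (Fin N ⊕ Fin N) (Equiv.swap a b)).map Complex.ofReal := by
      intro a b
      by_cases hab : a = b
      · subst hab
        rw [if_pos rfl, Equiv.swap_self, ← Equiv.Perm.one_def, permMat_one, one_map_ofReal]
        simp [two_smul]
      · simp [Equiv.Perm.sign_swap hab, hab]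
    simp only [h, Finset.sum_sub_distrib, Finset.sum_ite_eq]
    rw [Finset.sum_congr rfl fun a ha => if_pos ha, Finset.sum_const]
    congr 1
    · rw [← Nat.cast_smul_eq_nsmul ℂ, smul_smul, mul_comm]
    · ext j i
      simp [swapMat, Matrix.sum_apply]
  rw [hsum, permMat_one, one_map_ofReal]
  ext j i
  simp only [Matrix.smul_apply, Matrix.add_apply, Matrix.sub_apply, Matrix.map_apply,
    ofReal_one_apply, smul_eq_mul, Complex.ofReal_mul, Complex.ofReal_add, Complex.ofReal_inv,
    Complex.ofReal_ofNat, Complex.ofReal_natCast, Equiv.Perm.sign_one, Units.val_one,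
    Int.cast_one, one_mul]
  field_simp
  ring

theorem rhoO_epsilon (N : ℕ) :
    rhoO N n (1 - ((1 : ℂ) / (Nat.factorial N : ℂ)) • epsilon n (N : ℂ) N) =
      (1 - (1 / (Nat.factorial N) : ℝ) •
        antisymmMat (Fin N) (Finset.univ.filter fun k : Fin n => (k : ℕ) < N)).map
          Complex.ofReal := by
  have h1 : rhoO N n 1 = 1 := by
    rw [← one_map_ofReal, ← permMat_one (X := Fin n), ← rhoO_permDiagram]
    rfl
  rw [map_sub, map_smul, h1, epsilon_eq, map_sum]
  simp only [map_smul, rhoO_permDiagram]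
  ext j i
  simp [antisymmMat, Matrix.sum_apply, ofReal_one_apply]

/-- A transposition survives the projection exactly when both points lie on the same side of the
wall. The added `|C| / 2z` turns the coefficient `N - 2` into `N - 1`, that of the Casimir operator.
-/
theorem rhoO_YSet {m N : ℕ} (hN : N ≠ 0) (C : Finset (Fin (n + m))) :
    rhoO N (n + m) (YSet n m (N : ℂ) C) =
      ((2 * N : ℝ)⁻¹ • (((N - 1 : ℝ) * C.card) • 1 +
        (swapMat (Fin N) (C.filter fun k : Fin (n + m) => (k : ℕ) < n) +
          swapMat (Fin N) (C.filter fun k : Fin (n + m) => ¬ (k : ℕ) < n)))).map Complex.ofReal := by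
  classical
  have hN' : (N : ℂ) ≠ 0 := by exact_mod_cast hN
  have h1 : rhoO N (n + m) 1 = (1 : Matrix _ _ ℝ).map Complex.ofReal := by
    rw [← permMat_one, ← rhoO_permDiagram]
    rfl
  have hw : ∀ σ : Equiv.Perm (Fin (n + m)),
      (rhoO N (n + m) ∘ₗ wallProj n m (N : ℂ)) (BrauerAlgebra.of _ (permDiagram σ)) =
        if IsWalled (n := n) (m := m) (permDiagram σ) then
          (permMat (Fin N) σ).map Complex.ofReal else 0 := by
    intro σ
    rw [LinearMap.comp_apply, wallProj, extend_of]
    split_ifs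
    · exact rhoO_permDiagram N σ
    · exact map_zero _
  have hone : IsWalled (n := n) (m := m) (permDiagram (1 : Equiv.Perm (Fin (n + m)))) := by
    simp [isWalled_permDiagram]
  have hsum : ∑ a ∈ C, ∑ b ∈ C, (if ((a : ℕ) < n ↔ (b : ℕ) < n) then
      (permMat (Fin N) (Equiv.swap a b)).map Complex.ofReal else 0) =
      (swapMat (Fin N) (C.filter fun k : Fin (n + m) => (k : ℕ) < n) +
          swapMat (Fin N) (C.filter fun k : Fin (n + m) => ¬ (k : ℕ) < n)).map Complex.ofReal := by
    rw [← Finset.sum_filter_add_sum_filter_not C fun k : Fin (n + m) => (k : ℕ) < n]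
    ext j i
    simp only [Matrix.add_apply, Matrix.map_apply, swapMat, Matrix.sum_apply,
      Complex.ofReal_add, Complex.ofReal_sum]
    congr 1 <;> refine Finset.sum_congr rfl fun a ha => ?_ <;>
      rw [Finset.sum_filter] <;> refine Finset.sum_congr rfl fun b _ => ?_ <;>
      have ha := (Finset.mem_filter.1 ha).2 <;> by_cases hb : (b : ℕ) < n <;> simp [ha, hb]
  rw [YSet, map_add, map_smul, h1, ← LinearMap.comp_apply, map_ZSet _ hN']
  simp only [hw, isWalled_swap, if_pos hone, hsum, permMat_one]
  ext j i
  simp only [Matrix.smul_apply, Matrix.add_apply, Matrix.map_apply, ofReal_one_apply, smul_eq_mul,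
    Complex.ofReal_mul, Complex.ofReal_add, Complex.ofReal_sub, Complex.ofReal_inv,
    Complex.ofReal_ofNat, Complex.ofReal_natCast, Complex.ofReal_one]
  field_simp
  ring

end Representations

/-! ### The operator inequalities -/

section Inequalities

variable {n : ℕ} {N : ℕ}

theorem opGE_rhoO_Y {m i : ℕ} (hN : N ≠ 0) (hnm : n ≤ m) (hi : 1 ≤ i) (hin : i ≤ n) :
    OpGE (rhoO N (n + m) (Y n m (N : ℂ) i)) 1 := by
  rw [Y, rhoO_YSet hN, ← one_map_ofReal]
  set C := Finset.univ.filter fun k : Fin (n + m) =>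
    (k : ℕ) < i ∨ (n ≤ (k : ℕ) ∧ (k : ℕ) < m + i)
  set A := C.filter fun k : Fin (n + m) => (k : ℕ) < n
  set B := C.filter fun k : Fin (n + m) => ¬ (k : ℕ) < n
  have hN0 : (0 : ℝ) < N := by exact_mod_cast Nat.pos_of_ne_zero hN
  have hAB : Disjoint A B := Finset.disjoint_filter_filter_not _ _ _
  have hcard : (C.card : ℝ) = A.card + B.card := by
    exact_mod_cast (Finset.card_filter_add_card_filter_not (s := C) fun k => (k : ℕ) < n).symm
  have hA : 1 ≤ A.card := Finset.card_pos.2 ⟨⟨0, by omega⟩, by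
    simp only [A, C, Finset.mem_filter, Finset.mem_univ, true_and]; omega⟩
  -- Position `n` (counted from `0`) belongs to `C` because `n ≤ m < m + i`.
  have hB : 1 ≤ B.card := Finset.card_pos.2 ⟨⟨n, by omega⟩, by
    simp only [B, C, Finset.mem_filter, Finset.mem_univ, true_and]; omega⟩
  refine opGE_map_ofReal ?_ Matrix.isSymm_one fun f hf μ hμ => ?_
  · exact ((Matrix.isSymm_one.smul _).add ((swapMat_isSymm A).add (swapMat_isSymm B))).smul _
  obtain ⟨w₀, hw₀⟩ := Function.ne_iff.1 hf
  -- The number passed is the eigenvalue of `S_A + S_B` on `f`, obtained by solving the eigenvalue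
  -- equation for `Y - 1`.
  have h := eigenvalue_lower_bound_of_disjoint hAB f (2 * N * (1 + μ) - (N - 1) * C.card)
    (fun w => by
      have h := hμ w
      simp only [Matrix.smul_mulVec, Matrix.add_mulVec, Pi.smul_apply, Pi.add_apply,
        swapMat_mulVec, Matrix.one_mulVec, smul_eq_mul] at h
      field_simp at h
      linarith) w₀ hw₀
  have h1 := two_mul_card_le_weight (letterCount A w₀) (by rwa [sum_letterCount])
  have h2 := two_mul_card_le_weight (letterCount B w₀) (by rwa [sum_letterCount])
  rw [Fintype.card_fin] at h h1 h2
  rw [hcard] at h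
  have h3 : 0 ≤ N * μ := by linarith
  exact nonneg_of_mul_nonneg_right h3 hN0

theorem opGE_rhoS_Z {i : ℕ} (hN : N ≠ 0) (hi : 2 ≤ i) (hin : i ≤ n) :
    OpGE (rhoS N n (Z n (-2 * (N : ℂ)) i)) 1 := by
  rw [Z, rhoS_ZSet hN, ← one_map_ofReal]
  have hC := card_filter_lt hin
  set C := Finset.univ.filter fun k : Fin n => (k : ℕ) < i
  have hN0 : (0 : ℝ) < N := by exact_mod_cast Nat.pos_of_ne_zero hN
  refine opGE_map_ofReal ?_ Matrix.isSymm_one fun f hf μ hμ => ?_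
  · exact ((Matrix.isSymm_one.smul _).add (swapMat_isSymm C)).smul _
  obtain ⟨w₀, hw₀⟩ := Function.ne_iff.1 hf
  have h := eigenvalue_lower_bound C f (4 * N * (1 + μ) - 2 * N * C.card)
    (fun w => by
      have h := hμ w
      simp only [Matrix.smul_mulVec, Matrix.add_mulVec, Pi.smul_apply, Pi.add_apply,
        swapMat_mulVec, Matrix.one_mulVec, smul_eq_mul] at h
      field_simp at h
      linarith) w₀ hw₀
  have h1 := four_mul_card_le_weight_add (letterCount C w₀) (by rw [sum_letterCount]; omega)
  rw [← Nat.cast_sum, sum_letterCount] at h1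
  rw [Fintype.card_sum, Fintype.card_fin] at h h1
  push_cast at h h1
  have h3 : 0 ≤ N * μ := by linarith
  exact nonneg_of_mul_nonneg_right h3 hN0

theorem rhoS_Z_one (hN : N ≠ 0) (hn : 1 ≤ n) :
    rhoS N n (Z n (-2 * (N : ℂ)) 1) = ((2 * (N : ℂ) + 1) / (4 * (N : ℂ))) • 1 := by
  have hC : (Finset.univ.filter fun k : Fin n => (k : ℕ) < 1) = {⟨0, hn⟩} := by
    ext k
    simp [Fin.ext_iff]
  have hN' : (N : ℝ) ≠ 0 := by exact_mod_cast hN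
  have : (4 * N : ℝ)⁻¹ • ((2 * N * (1 : ℕ) : ℝ) • 1 + swapMat (Fin N ⊕ Fin N) {(⟨0, hn⟩ : Fin n)}) =
      ((2 * N + 1) / (4 * N) : ℝ) • 1 := by
    rw [swapMat, Finset.sum_singleton, Finset.sum_singleton, Equiv.swap_self,
      ← Equiv.Perm.one_def, permMat_one]
    module
  rw [Z, rhoS_ZSet hN, hC, Finset.card_singleton, this, smul_one_map_ofReal]
  push_cast
  rfl

theorem opGE_rhoO_Z {i : ℕ} (hN : N ≠ 0) (hi : 1 ≤ i) (hin : i ≤ n) (hiN : i ≠ N) :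
    OpGE (rhoO N n (Z n (N : ℂ) i)) ((((N : ℂ) - 1) / (2 * (N : ℂ))) • 1) := by
  have hr : ((N : ℂ) - 1) / (2 * (N : ℂ)) = (((N - 1) / (2 * N) : ℝ) : ℂ) := by push_cast; rfl
  rw [Z, rhoO_ZSet hN, hr, ← smul_one_map_ofReal]
  have hC := card_filter_lt hin
  set C := Finset.univ.filter fun k : Fin n => (k : ℕ) < i
  have hN0 : (0 : ℝ) < N := by exact_mod_cast Nat.pos_of_ne_zero hN
  refine opGE_map_ofReal ?_ (Matrix.isSymm_one.smul _) fun f hf μ hμ => ?_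
  · exact ((Matrix.isSymm_one.smul _).add (swapMat_isSymm C)).smul _
  obtain ⟨w₀, hw₀⟩ := Function.ne_iff.1 hf
  have h := eigenvalue_lower_bound C f (2 * N * μ + (N - 1) - (N - 2) * C.card)
    (fun w => by
      have h := hμ w
      simp only [Matrix.smul_mulVec, Matrix.add_mulVec, Pi.smul_apply, Pi.add_apply,
        swapMat_mulVec, Matrix.one_mulVec, smul_eq_mul] at h
      field_simp at h
      linarith) w₀ hw₀
  have h1 := two_mul_card_sub_one_le_weight (letterCount C w₀) (by rw [sum_letterCount]; omega)
    (by
      -- If every letter occurred exactly once in `C`, then `i = N`.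
      by_contra hk
      push Not at hk
      have hs := sum_letterCount C w₀
      simp only [hk, Finset.sum_const, Finset.card_univ, Fintype.card_fin] at hs
      simp only [smul_eq_mul, mul_one] at hs
      omega)
  rw [← Nat.cast_sum, sum_letterCount] at h1
  rw [Fintype.card_fin] at h h1
  have h3 : 0 ≤ N * μ := by linarith
  exact nonneg_of_mul_nonneg_right h3 hN0

theorem opGE_rhoO_Z_self (hN : N ≠ 0) (hn : N ≤ n) :
    OpGE (rhoO N n (Z n (N : ℂ) N))
      (rhoO N n (1 - ((1 : ℂ) / (Nat.factorial N : ℂ)) • epsilon n (N : ℂ) N)) := by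
  rw [Z, rhoO_ZSet hN, rhoO_epsilon]
  have hC := card_filter_lt hn
  set C := Finset.univ.filter fun k : Fin n => (k : ℕ) < N
  refine opGE_map_ofReal ?_ ?_ fun f hf μ hμ => ?_
  · exact ((Matrix.isSymm_one.smul _).add (swapMat_isSymm C)).smul _
  · exact Matrix.isSymm_one.sub ((antisymmMat_isSymm C).smul _)
  refine gap_nonneg C (by rw [hC, Fintype.card_fin]) (by omega) f hf μ fun w => ?_
  rw [← hμ w, hC]
  simp only [Matrix.smul_mulVec, Matrix.add_mulVec, Matrix.sub_mulVec, Pi.smul_apply,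
    Pi.add_apply, Pi.sub_apply, swapMat_mulVec, antisymmMat_mulVec, Matrix.one_mulVec,
    smul_eq_mul, one_div]

end Inequalities

end BrauerTensor

end

theorem mainTheorem8 (N : ℕ) (hN : 1 < N) :
    (∀ n m i : ℕ, n ≤ m → 1 ≤ i → i ≤ n →
      BrauerTensor.OpGE (BrauerTensor.rhoO N (n + m) (BrauerTensor.Y n m (N : ℂ) i)) 1) ∧
    (∀ n i : ℕ, 2 ≤ i → i ≤ n →
      BrauerTensor.OpGE (BrauerTensor.rhoS N n (BrauerTensor.Z n (-2 * (N : ℂ)) i)) 1) ∧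
    (∀ n : ℕ, 1 ≤ n →
      BrauerTensor.rhoS N n (BrauerTensor.Z n (-2 * (N : ℂ)) 1) =
        ((2 * (N : ℂ) + 1) / (4 * (N : ℂ))) • 1) ∧
    (∀ n i : ℕ, 1 ≤ i → i ≤ n → i ≠ N →
      BrauerTensor.OpGE (BrauerTensor.rhoO N n (BrauerTensor.Z n (N : ℂ) i))
        ((((N : ℂ) - 1) / (2 * (N : ℂ))) • 1)) ∧
    (∀ n : ℕ, N ≤ n →
      BrauerTensor.OpGE (BrauerTensor.rhoO N n (BrauerTensor.Z n (N : ℂ) N))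
        (BrauerTensor.rhoO N n
          (1 - ((1 : ℂ) / (Nat.factorial N : ℂ)) • BrauerTensor.epsilon n (N : ℂ) N)) ∧
      BrauerTensor.epsilon n (N : ℂ) N * BrauerTensor.Z n (N : ℂ) N = 0) := by
  have hN0 : N ≠ 0 := by omega
  exact ⟨fun n m i hnm hi hin => BrauerTensor.opGE_rhoO_Y hN0 hnm hi hin,
    fun n i hi hin => BrauerTensor.opGE_rhoS_Z hN0 hi hin,
    fun n hn => BrauerTensor.rhoS_Z_one hN0 hn,
    fun n i hi hin hiN => BrauerTensor.opGE_rhoO_Z hN0 hi hin hiN,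
    fun n hn => ⟨BrauerTensor.opGE_rhoO_Z_self hN0 hn, BrauerTensor.epsilon_mul_Z hN0 hn⟩⟩
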